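/- **Setting.** Let $\mathbf x_1,\dots,\mathbf x_n\in\mathbb R^q$ ($n,q\ge1$) be i.i.d. Gaussian vectors with (arbitrary) mean and positive definite covariance matrix $\Sigma^\star=(\sigma^\star_{ij})$, let $\hat\Sigma_n=\frac1n\sum_i(\mathbf x_i-\bar{\mathbf x})(\mathbf x_i-\bar{\mathbf x})'$ be the sample covariance matrix, and let $\Theta^\star=(\Sigma^\star)^{-1}=(\theta^\star_{jk})$ be the precision matrix. Put $\mathcal A=\{(j,k):\theta^\star_{jk}\ne0\}$, $p=q(q+1)/2$, $s=\#\{(j,k):j\le k,\ \theta^\star_{jk}\neq0\}$, $d=\max_j\#\{k:\theta^\star_{jk}\ne0\}$, $\|\Theta^\star_{\mathcal A}\|_{\min}=\min_{(j,k)\in\mathcal A}|\theta^\star_{jk}|$, $H^\star=\Sigma^\star\otimes\Sigma^\star$ (rows and columns indexed by pairs $(j,k)$). For a matrix $U$ let $\|U\|_{\ell_1}=\max_j\sum_i|u_{ij}|$, $\|U\|_{\ell_\infty}=\max_i\sum_j|u_{ij}|$, $\|U\|_1=\sum_{i,j}|u_{ij}|$, $\|U\|_{\max}=\max_{i,j}|u_{ij}|$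 (a maximum over no rows is $0$), and put $$L=\|\Theta^\star\|_{\ell_1},\quad K_1=\|\Sigma^\star\|_{\ell_\infty},\quad K_2=\|(H^\star_{\mathcal A\mathcal A})^{-1}\|_{\ell_\infty},\quad K_3=\|H^\star_{\mathcal A^c\mathcal A}(H^\star_{\mathcal A\mathcal A})^{-1}\|_{\ell_\infty}.$$ **Penalty.** Let $a_1,a_2>0$, $a>a_2$, $a_0=\min\{1,a_2\}$, and let $P_\lambda$ be a folded concave penalty: (i) $P_\lambda$ is nondecreasing and concave on $[0,\infty)$ with $P_\lambda(0)=0$; (ii) $P_\lambda$ is differentiable on $(0,\infty)$, and the limit $P'_\lambda(0):=P'_\lambda(0+)$ exists, is finite and is $\ge a_1\lambda$; (iii) $P'_\lambda(t)\ge a_1\lambda$ for $t\in(0,a_2\lambda]$; (iv) $P'_\lambda(t)=0$ for $t\ge a\lambda$. **Estimators.** Let $\ell_n(\Theta)=-\log\det\Theta+\langle\Theta,\hat\Sigma_n\rangle$. The oracle estimator $\hat\Theta^{\rm oracle}$ is the minimizer of $\ell_n$ over positive definite $\Theta$ with $\Theta_{\mathcal A^c}=0$. A CLIME estimator $\hat\Theta^{\rm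 clime}$ is any minimizer of $\|\Theta\|_1$ over matrices $\Theta$ with $\|\hat\Sigma_n\Theta-I\|_{\max}\le\lambda_{\rm clime}$. The LLA algorithm initialized by $\hat\Theta^{(0)}$ takes for $\hat\Theta^{(m)}$, $m\ge1$, a minimizer of $\ell_n(\Theta)+\sum_{j\ne k}P'_\lambda(|\hat\theta^{(m-1)}_{jk}|)\,|\theta_{jk}|$ over positive definite $\Theta$. **Claim.** For every $M>0$ there are constants $C_0,c_0>0$, depending only on $M$, such that the following holds for all such data with $\max_i\sigma^\star_{ii}=M$. If $\|\Theta^\star_{\mathcal A}\|_{\min}>(a+1)\lambda$, $\lambda_{\rm clime}>0$ and $\lambda\ge\frac{4L}{a_0}\lambda_{\rm clime}$, then with probability at least $$1-C_0\,p\exp\Bigl(-\frac{c_0n}{L^2}\lambda_{\rm clime}^2\Bigr)-\delta_1^G-\delta_2^G$$ the oracle estimator exists and is unique, a CLIME estimator exists, and the LLA algorithm initialized by any CLIME estimator converges to $\hat\Theta^{\rm oracle}$ after two iterations: $\hat\Theta^{(1)}$ is uniquely determined and equals $\hat\Theta^{\rm oracle}$, the second iteration returns $\hat\Theta^{\rm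 oracle}$ again, and so do all later ones. Here $$\delta_1^G=C_0s\exp\Bigl(-\frac{c_0}{4}n\min\Bigl\{\frac{a_1^2\lambda^2}{(2K_3+1)^2},\frac1{9K_1^2K_2^2d^2},\frac1{9K_1^6K_2^4d^2}\Bigr\}\Bigr)+C_0(p-s)\exp\Bigl(-\frac{c_0a_1^2}{4}n\lambda^2\Bigr),$$ $$\delta_2^G=C_0s\exp\Bigl(-\frac{c_0n}{4K_2^2}\min\Bigl\{\frac1{9K_1^2d^2},\frac1{9K_1^6K_2^2d^2},\bigl(\|\Theta^\star_{\mathcal A}\|_{\min}-a\lambda\bigr)^2\Bigr\}\Bigr).$$ No irrepresentable condition (such as $K_3<1$) is assumed. -/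

import Mathlib

open MeasureTheory ProbabilityTheory Filter Topology Matrix
open scoped Kronecker

noncomputable section

namespace PrecisionLLA

/-! ### Matrix norms -/

/-- The norm `‖U‖_{ℓ₁}`: maximal absolute column sum. -/
def normL1 {k l : Type*} [Fintype k] (U : Matrix k l ℝ) : ℝ :=
  ⨆ j, ∑ i, |U i j|

/-- The norm `‖U‖_{ℓ∞}`: maximal absolute row sum (zero if there are no rows). -/
def normLinf {k l : Type*} [Fintype l] (U : Matrix k l ℝ) : ℝ :=
  ⨆ i, ∑ j, |U i j|

/-- The entrywise `ℓ₁` norm `‖U‖₁`. -/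
def entryL1 {k l : Type*} [Fintype k] [Fintype l] (U : Matrix k l ℝ) : ℝ :=
  ∑ i, ∑ j, |U i j|

/-- The entrywise maximum norm `‖U‖_max`. -/
def entryMax {k l : Type*} (U : Matrix k l ℝ) : ℝ :=
  ⨆ e : k × l, |U e.1 e.2|

/-! ### Support, sparsity and the quantities attached to the true model -/

/-- The support `𝒜 = {(j,k) : θ_{jk} ≠ 0}`. -/
def supp {q : ℕ} (Th : Matrix (Fin q) (Fin q) ℝ) : Finset (Fin q × Fin q) :=
  Finset.univ.filter fun e => Th e.1 e.2 ≠ 0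

/-- `s = #{(j,k) : j ≤ k, θ_{jk} ≠ 0}`. -/
def sparsity {q : ℕ} (Th : Matrix (Fin q) (Fin q) ℝ) : ℕ :=
  ((supp Th).filter fun e => e.1 ≤ e.2).card

/-- The maximal degree `d = max_j #{k : θ_{jk} ≠ 0}`. -/
def maxDegree {q : ℕ} (Th : Matrix (Fin q) (Fin q) ℝ) : ℕ :=
  Finset.univ.sup fun j => (Finset.univ.filter fun k => Th j k ≠ 0).card

/-- `‖Θ_𝒜‖_min`, the smallest absolute value of a nonzero entry of `Θ`. -/
def minSignal {q : ℕ} (Th : Matrix (Fin q) (Fin q) ℝ) : ℝ :=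
  ⨅ e : supp Th, |Th e.1.1 e.1.2|

/-- The dimension `p = q (q + 1) / 2` of the parameter (a symmetric `q × q` matrix). -/
def dimParam (q : ℕ) : ℝ := (q : ℝ) * ((q : ℝ) + 1) / 2

/-- `max_i σ_{ii}`. -/
def maxVar {q : ℕ} (Sg : Matrix (Fin q) (Fin q) ℝ) : ℝ := ⨆ i, Sg i i

/-- `H⋆ = Σ⋆ ⊗ Σ⋆`. -/
def hess {q : ℕ} (Sg : Matrix (Fin q) (Fin q) ℝ) :
    Matrix (Fin q × Fin q) (Fin q × Fin q) ℝ := Sg ⊗ₖ Sg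

/-- The block `H⋆_{ℬ𝒞}` of `H⋆`. -/
def hessBlock {q : ℕ} (Sg : Matrix (Fin q) (Fin q) ℝ) (B C : Finset (Fin q × Fin q)) :
    Matrix B C ℝ := (hess Sg).submatrix Subtype.val Subtype.val

/-- `K₁ = ‖Σ⋆‖_{ℓ∞}`. -/
def K1 {q : ℕ} (Sg : Matrix (Fin q) (Fin q) ℝ) : ℝ := normLinf Sg

/-- `K₂ = ‖(H⋆_{𝒜𝒜})⁻¹‖_{ℓ∞}`, with `𝒜` the support of `Θ⋆ = (Σ⋆)⁻¹`. -/
def K2 {q : ℕ} (Sg : Matrix (Fin q) (Fin q) ℝ) : ℝ :=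
  normLinf (hessBlock Sg (supp Sg⁻¹) (supp Sg⁻¹))⁻¹

/-- `K₃ = ‖H⋆_{𝒜ᶜ𝒜} (H⋆_{𝒜𝒜})⁻¹‖_{ℓ∞}`. -/
def K3 {q : ℕ} (Sg : Matrix (Fin q) (Fin q) ℝ) : ℝ :=
  normLinf (hessBlock Sg (supp Sg⁻¹)ᶜ (supp Sg⁻¹) *
    (hessBlock Sg (supp Sg⁻¹) (supp Sg⁻¹))⁻¹)

/-- The exception probability `δ₁^G`. -/
def delta1 {q : ℕ} (C₀ c₀ : ℝ) (n : ℕ) (Sg : Matrix (Fin q) (Fin q) ℝ) (a₁ lam : ℝ) : ℝ :=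
  C₀ * (sparsity Sg⁻¹ : ℝ) *
      Real.exp (-(c₀ / 4) * n *
        min (a₁ ^ 2 * lam ^ 2 / (2 * K3 Sg + 1) ^ 2)
          (min (1 / (9 * K1 Sg ^ 2 * K2 Sg ^ 2 * (maxDegree Sg⁻¹ : ℝ) ^ 2))
            (1 / (9 * K1 Sg ^ 6 * K2 Sg ^ 4 * (maxDegree Sg⁻¹ : ℝ) ^ 2)))) +
    C₀ * (dimParam q - (sparsity Sg⁻¹ : ℝ)) *
      Real.exp (-(c₀ * a₁ ^ 2 / 4) * n * lam ^ 2)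

/-- The exception probability `δ₂^G`. -/
def delta2 {q : ℕ} (C₀ c₀ : ℝ) (n : ℕ) (Sg : Matrix (Fin q) (Fin q) ℝ) (a lam : ℝ) : ℝ :=
  C₀ * (sparsity Sg⁻¹ : ℝ) *
    Real.exp (-(c₀ * n / (4 * K2 Sg ^ 2)) *
      min (1 / (9 * K1 Sg ^ 2 * (maxDegree Sg⁻¹ : ℝ) ^ 2))
        (min (1 / (9 * K1 Sg ^ 6 * K2 Sg ^ 2 * (maxDegree Sg⁻¹ : ℝ) ^ 2))
          ((minSignal Sg⁻¹ - a * lam) ^ 2)))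

/-! ### Folded concave penalties -/

/-- The derivative `P'` of a penalty on `[0, ∞)`, with `P'(0) := P'(0+)`. -/
def penDeriv (P : ℝ → ℝ) (t : ℝ) : ℝ :=
  if t = 0 then limUnder (𝓝[>] (0 : ℝ)) (deriv P) else deriv P t

/-- `P = P_λ` is a folded concave penalty with constants `a`, `a₁`, `a₂`. Only the values of
`P` on `[0, ∞)` matter. -/
structure IsFoldedConcave (P : ℝ → ℝ) (lam a a₁ a₂ : ℝ) : Prop where
  a₁_pos : 0 < a₁
  a₂_pos : 0 < a₂
  a₂_lt : a₂ < a
  mono : MonotoneOn P (Set.Ici 0)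
  concave : ConcaveOn ℝ (Set.Ici 0) P
  zero : P 0 = 0
  differentiable : ∀ t, 0 < t → DifferentiableAt ℝ P t
  tendsto_deriv : ∃ w, Tendsto (deriv P) (𝓝[>] (0 : ℝ)) (𝓝 w)
  deriv_zero : a₁ * lam ≤ penDeriv P 0
  deriv_near : ∀ t, 0 < t → t ≤ a₂ * lam → a₁ * lam ≤ penDeriv P t
  deriv_far : ∀ t, a * lam ≤ t → penDeriv P t = 0

/-! ### Data, loss, oracle, CLIME and the LLA algorithm -/

/-- The sample mean. -/
def sampleMean {n q : ℕ} (x : Fin n → EuclideanSpace ℝ (Fin q)) (j : Fin q) : ℝ :=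
  (n : ℝ)⁻¹ * ∑ i, x i j

/-- The sample covariance matrix `n⁻¹ ∑ᵢ (xᵢ - x̄)(xᵢ - x̄)'`. -/
def sampleCov {n q : ℕ} (x : Fin n → EuclideanSpace ℝ (Fin q)) : Matrix (Fin q) (Fin q) ℝ :=
  Matrix.of fun j k =>
    (n : ℝ)⁻¹ * ∑ i, (x i j - sampleMean x j) * (x i k - sampleMean x k)

/-- The Gaussian quasi-likelihood loss `-log det Θ + ⟨Θ, S⟩`. -/
def loss {q : ℕ} (S Th : Matrix (Fin q) (Fin q) ℝ) : ℝ :=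
  -Real.log Th.det + (Thᵀ * S).trace

/-- `T` minimizes the loss over the positive definite matrices that vanish off `A`. -/
def IsOracle {q : ℕ} (S : Matrix (Fin q) (Fin q) ℝ) (A : Finset (Fin q × Fin q))
    (T : Matrix (Fin q) (Fin q) ℝ) : Prop :=
  T ∈ {Th : Matrix (Fin q) (Fin q) ℝ | Th.PosDef ∧ ∀ e ∉ A, Th e.1 e.2 = 0} ∧
    IsMinOn (loss S) {Th : Matrix (Fin q) (Fin q) ℝ | Th.PosDef ∧ ∀ e ∉ A, Th e.1 e.2 = 0} T

/-- `T` is a CLIME estimator: it minimizes `‖Θ‖₁` subject to `‖S Θ - I‖_max ≤ λ_clime`. -/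
def IsClime {q : ℕ} (S : Matrix (Fin q) (Fin q) ℝ) (lamClime : ℝ)
    (T : Matrix (Fin q) (Fin q) ℝ) : Prop :=
  T ∈ {Th : Matrix (Fin q) (Fin q) ℝ | entryMax (S * Th - 1) ≤ lamClime} ∧
    IsMinOn entryL1 {Th : Matrix (Fin q) (Fin q) ℝ | entryMax (S * Th - 1) ≤ lamClime} T

/-- The reweighted `ℓ₁` problem solved in one LLA iteration, with the weights
`w_{jk} = P'(|θ_{jk}|)`, `j ≠ k`, computed from the previous iterate `Th₀`. -/
def llaObjective {q : ℕ} (P : ℝ → ℝ) (S Th₀ Th : Matrix (Fin q) (Fin q) ℝ) : ℝ :=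
  loss S Th +
    ∑ e ∈ Finset.univ.filter (fun e : Fin q × Fin q => e.1 ≠ e.2),
      penDeriv P |Th₀ e.1 e.2| * |Th e.1 e.2|

/-- `T` is a possible outcome of one LLA iteration started at `Th₀`. -/
def IsLLAStep {q : ℕ} (P : ℝ → ℝ) (S Th₀ T : Matrix (Fin q) (Fin q) ℝ) : Prop :=
  T ∈ {Th : Matrix (Fin q) (Fin q) ℝ | Th.PosDef} ∧
    IsMinOn (llaObjective P S Th₀) {Th : Matrix (Fin q) (Fin q) ℝ | Th.PosDef} T

/-- The set of possible `m`-th iterates of the LLA algorithm initialized by `Th₀`. -/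
def llaIterates {q : ℕ} (P : ℝ → ℝ) (S Th₀ : Matrix (Fin q) (Fin q) ℝ) :
    ℕ → Set (Matrix (Fin q) (Fin q) ℝ)
  | 0 => {Th₀}
  | m + 1 => {T | ∃ U ∈ llaIterates P S Th₀ m, IsLLAStep P S U T}

end PrecisionLLA

end

noncomputable section

namespace PrecisionLLA

/-! ### Convexity of the loss -/

/-! Write `W = S - Sg` for the noise. The theorem splits into a deterministic statement,
`lla_eq_oracle_of_noise_le`, and a tail bound for the entries of `W`.

Deterministic part. The loss has gradient `S - X⁻¹` and lies above its tangents, with equality only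
at the base point, because `log x ≤ x - 1` with equality only at `x = 1`. First order conditions are
therefore sufficient and determine the minimizer, for the oracle (`isOracle_iff_eq`) and for each
reweighted problem (`isLLAStep_iff_eq`). If `|W| ≤ t` on the support, `exists_restricted_stationary`
gives a positive definite `T` whose gradient vanishes on the support. It lies within `2 K₂ t` of the
precision matrix, and its gradient off the support exceeds `|W|` by at most `(2 K₃ + 1) t`. The
choice of `t`, together with `|W| ≤ a₁ λ / 2` off the support, keeps that gradient below `a₁ λ`; no
bound on `K₃` is needed. If moreover `|W| ≤ λ_clime / L` everywhere, CLIME has entrywise error at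
most `a₀ λ`. Then its entries on the support are at least `a λ`, so those weights vanish, and off
the support they are at most `a₂ λ`, so the weights dominate the gradient. Hence one step from CLIME
gives `T`. The matrix `T` has the same two properties, so it is a fixed point of the iteration.

Probabilistic part. Polarization reduces an entry of the sample covariance to two sample variances
of Gaussian samples, treated by Chernoff bounds. The resulting tail is available only for radii up
to `M`, whereas the radii in the exponents are not bounded by `M`. Since `λ_clime / L ≤ M`
(`clime_radius_le`), it suffices to count exceedances of a radius by entries that stay below
`λ_clime / L`. Union bounds over the upper triangle produce the factors `p`, `s` and `p - s`. -/

/-- The Frobenius inner product of two square matrices. -/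
def frob {q : ℕ} (A B : Matrix (Fin q) (Fin q) ℝ) : ℝ :=
  ∑ e : Fin q × Fin q, A e.1 e.2 * B e.1 e.2

lemma frob_eq_trace {q : ℕ} (A B : Matrix (Fin q) (Fin q) ℝ) : frob A B = (Aᵀ * B).trace := by
  simp only [frob, Matrix.trace, Matrix.diag, Matrix.mul_apply, Matrix.transpose_apply,
    Fintype.sum_prod_type]
  exact Finset.sum_comm

lemma frob_comm {q : ℕ} (A B : Matrix (Fin q) (Fin q) ℝ) : frob A B = frob B A := by
  simp [frob, mul_comm]

lemma frob_sub_right {q : ℕ} (A B C : Matrix (Fin q) (Fin q) ℝ) :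
    frob A (B - C) = frob A B - frob A C := by
  simp [frob, mul_sub, Finset.sum_sub_distrib]

lemma frob_sub_left {q : ℕ} (A B C : Matrix (Fin q) (Fin q) ℝ) :
    frob (A - B) C = frob A C - frob B C := by
  simp [frob, sub_mul, Finset.sum_sub_distrib]

lemma frob_smul_right {q : ℕ} (c : ℝ) (A B : Matrix (Fin q) (Fin q) ℝ) :
    frob A (c • B) = c * frob A B := by
  simp only [frob, Matrix.smul_apply, smul_eq_mul, Finset.mul_sum]
  exact Finset.sum_congr rfl fun _ _ => by ring

lemma frob_add_right {q : ℕ} (A B C : Matrix (Fin q) (Fin q) ℝ) :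
    frob A (B + C) = frob A B + frob A C := by
  simp [frob, mul_add, Finset.sum_add_distrib]

lemma frob_transpose {q : ℕ} (A B : Matrix (Fin q) (Fin q) ℝ) :
    frob A Bᵀ = frob Aᵀ B := by
  simp only [frob, Matrix.transpose_apply, Fintype.sum_prod_type]
  exact Finset.sum_comm

lemma loss_eq {q : ℕ} (S X : Matrix (Fin q) (Fin q) ℝ) :
    loss S X = -Real.log X.det + frob S X := by
  rw [loss, frob_comm, frob_eq_trace]

lemma exists_unit_factor {q : ℕ} {X : Matrix (Fin q) (Fin q) ℝ} (hX : X.PosDef) :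
    ∃ C : Matrix (Fin q) (Fin q) ℝ, IsUnit C ∧ X = Cᵀ * C := by
  open scoped MatrixOrder in
  obtain ⟨C, hC⟩ := CStarAlgebra.nonneg_iff_eq_star_mul_self.mp hX.posSemidef.nonneg
  refine ⟨C, ?_, by rw [hC]; simp [Matrix.star_eq_conjTranspose]⟩
  have h := (Matrix.isUnit_iff_isUnit_det _).mp hX.isUnit
  rw [hC, Matrix.det_mul] at h
  exact (Matrix.isUnit_iff_isUnit_det _).mpr (isUnit_of_mul_isUnit_right h)

/-- Sum `log x ≤ x - 1` over the eigenvalues. -/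
lemma log_det_le {q : ℕ} {N : Matrix (Fin q) (Fin q) ℝ} (hN : N.PosDef) :
    Real.log N.det ≤ N.trace - q := by
  have hpos := fun i => hN.eigenvalues_pos i
  rw [hN.1.det_eq_prod_eigenvalues, hN.1.trace_eq_sum_eigenvalues]
  simp only [RCLike.ofReal_real_eq_id, id]
  rw [Real.log_prod (fun i _ => (hpos i).ne')]
  calc _ ≤ ∑ i, (hN.1.eigenvalues i - 1) :=
        Finset.sum_le_sum fun i _ => Real.log_le_sub_one_of_pos (hpos i)
    _ = _ := by simp

lemma eq_one_of_log_det_eq {q : ℕ} {N : Matrix (Fin q) (Fin q) ℝ} (hN : N.PosDef)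
    (h : N.trace - q ≤ Real.log N.det) : N = 1 := by
  have hpos := fun i => hN.eigenvalues_pos i
  rw [hN.1.det_eq_prod_eigenvalues, hN.1.trace_eq_sum_eigenvalues] at h
  simp only [RCLike.ofReal_real_eq_id, id] at h
  rw [Real.log_prod (fun i _ => (hpos i).ne')] at h
  have hev : ∀ i, hN.1.eigenvalues i = 1 := by
    by_contra! hne
    obtain ⟨i, hi⟩ := hne
    have : ∑ i, Real.log (hN.1.eigenvalues i) < ∑ i, (hN.1.eigenvalues i - 1) :=
      Finset.sum_lt_sum (fun i _ => Real.log_le_sub_one_of_pos (hpos i))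
        ⟨i, Finset.mem_univ _, Real.log_lt_sub_one_of_pos (hpos i) hi⟩
    simp at this
    linarith
  have hs := hN.1.spectral_theorem
  have hd : (Matrix.diagonal (RCLike.ofReal ∘ hN.1.eigenvalues) :
      Matrix (Fin q) (Fin q) ℝ) = 1 := by
    rw [← Matrix.diagonal_one]
    congr 1
    ext i
    simp [hev]
  rw [hd, map_one] at hs
  exact hs

/-- Congruence by the inverse factor of `X` transports `Y` to a positive definite matrix with
determinant `det Y / det X` and trace `⟨X⁻¹, Y⟩`. -/
lemma exists_whitened {q : ℕ} {X Y : Matrix (Fin q) (Fin q) ℝ} (hX : X.PosDef) (hY : Y.PosDef) :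
    ∃ N : Matrix (Fin q) (Fin q) ℝ, N.PosDef ∧ Real.log N.det = Real.log Y.det - Real.log X.det ∧
      N.trace = frob X⁻¹ Y ∧ (N = 1 → Y = X) := by
  obtain ⟨C, hC, hXC⟩ := exists_unit_factor hX
  have hCd := (Matrix.isUnit_iff_isUnit_det _).mp hC
  have hCtd : IsUnit Cᵀ.det := by rwa [Matrix.det_transpose]
  refine ⟨(C⁻¹)ᵀ * Y * C⁻¹, ?_, ?_, ?_, ?_⟩
  · have : IsUnit (C⁻¹) := by
      rw [Matrix.isUnit_iff_isUnit_det, Matrix.det_nonsing_inv]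
      exact hCd.ringInverse
    have h := (Matrix.IsUnit.posDef_star_left_conjugate_iff (x := Y) this).mpr hY
    simpa [Matrix.star_eq_conjTranspose] using h
  · have hXd : X.det = C.det * C.det := by rw [hXC, Matrix.det_mul, Matrix.det_transpose]
    have h0 : C.det ≠ 0 := hCd.ne_zero
    rw [Matrix.det_mul, Matrix.det_mul, Matrix.det_transpose, Matrix.det_nonsing_inv,
      Ring.inverse_eq_inv', ← Real.log_div hY.det_pos.ne' hX.det_pos.ne', hXd]
    congr 1
    field_simp
  · have hXt : (X⁻¹)ᵀ = C⁻¹ * (C⁻¹)ᵀ := by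
      rw [hXC, Matrix.mul_inv_rev, Matrix.transpose_mul, Matrix.transpose_nonsing_inv,
        Matrix.transpose_transpose, Matrix.transpose_nonsing_inv]
    rw [frob_eq_trace, Matrix.trace_mul_comm, hXt, Matrix.mul_assoc]
  · intro h
    have h1 : (C⁻¹)ᵀ * Y * C⁻¹ * C = C := by rw [h, one_mul]
    rw [Matrix.mul_assoc, Matrix.nonsing_inv_mul _ hCd, mul_one, Matrix.transpose_nonsing_inv] at h1
    have h2 : Cᵀ * (Cᵀ⁻¹ * Y) = Cᵀ * C := by rw [h1]
    rw [← Matrix.mul_assoc, Matrix.mul_nonsing_inv _ hCtd, one_mul] at h2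
    rw [h2, hXC]

lemma frob_inv_self {q : ℕ} {X : Matrix (Fin q) (Fin q) ℝ} (hX : X.PosDef) :
    frob X⁻¹ X = q := by
  have hs : (X⁻¹)ᵀ = X⁻¹ := by
    simpa using hX.inv.1.eq
  rw [frob_eq_trace, hs, Matrix.nonsing_inv_mul _ ((Matrix.isUnit_iff_isUnit_det _).mp hX.isUnit),
    Matrix.trace_one, Fintype.card_fin]

/-- The tangent inequality of the convex function `loss S`. -/
lemma loss_tangent_le {q : ℕ} (S : Matrix (Fin q) (Fin q) ℝ) {X Y : Matrix (Fin q) (Fin q) ℝ}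
    (hX : X.PosDef) (hY : Y.PosDef) : loss S X + frob (S - X⁻¹) (Y - X) ≤ loss S Y := by
  obtain ⟨N, hN, hd, ht, -⟩ := exists_whitened hX hY
  have := log_det_le hN
  rw [loss_eq, loss_eq, frob_sub_left, frob_sub_right, frob_sub_right, frob_inv_self hX]
  linarith

/-- Strict convexity: equality in the tangent bound forces every eigenvalue of the whitened matrix
to be 1. Every uniqueness claim rests on this. -/
lemma eq_of_loss_le_tangent {q : ℕ} (S : Matrix (Fin q) (Fin q) ℝ)
    {X Y : Matrix (Fin q) (Fin q) ℝ} (hX : X.PosDef) (hY : Y.PosDef)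
    (h : loss S Y ≤ loss S X + frob (S - X⁻¹) (Y - X)) : Y = X := by
  obtain ⟨N, hN, hd, ht, hN1⟩ := exists_whitened hX hY
  refine hN1 (eq_one_of_log_det_eq hN ?_)
  rw [loss_eq, loss_eq, frob_sub_left, frob_sub_right, frob_sub_right, frob_inv_self hX] at h
  linarith

/-! ### Row sum norms -/

section Norms

variable {k l m : Type*}

lemma row_sum_le_normLinf [Finite k] [Fintype l] (U : Matrix k l ℝ) (i : k) :
    ∑ j, |U i j| ≤ normLinf U :=
  le_ciSup (f := fun i => ∑ j, |U i j|) (Set.finite_range _).bddAbove i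

lemma normLinf_nonneg [Fintype l] (U : Matrix k l ℝ) : 0 ≤ normLinf U :=
  Real.iSup_nonneg fun _ => Finset.sum_nonneg fun _ _ => abs_nonneg _

lemma normLinf_le [Fintype l] {U : Matrix k l ℝ} {c : ℝ} (hc : 0 ≤ c)
    (h : ∀ i, ∑ j, |U i j| ≤ c) : normLinf U ≤ c :=
  Real.iSup_le h hc

lemma abs_sum_mul_le_normLinf [Finite k] [Fintype l] (U : Matrix k l ℝ) (v : l → ℝ) {c : ℝ}
    (hv : ∀ j, |v j| ≤ c) (hc : 0 ≤ c) (i : k) : |∑ j, U i j * v j| ≤ normLinf U * c := by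
  calc |∑ j, U i j * v j| ≤ ∑ j, |U i j * v j| := Finset.abs_sum_le_sum_abs _ _
    _ ≤ ∑ j, |U i j| * c := Finset.sum_le_sum fun j _ => by
        rw [abs_mul]; exact mul_le_mul_of_nonneg_left (hv j) (abs_nonneg _)
    _ = (∑ j, |U i j|) * c := by rw [Finset.sum_mul]
    _ ≤ normLinf U * c := mul_le_mul_of_nonneg_right (row_sum_le_normLinf U i) hc

lemma normLinf_mul_le [Finite k] [Fintype l] [Fintype m] (U : Matrix k l ℝ) (V : Matrix l m ℝ) :
    normLinf (U * V) ≤ normLinf U * normLinf V := by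
  refine normLinf_le (mul_nonneg (normLinf_nonneg _) (normLinf_nonneg _)) fun i => ?_
  calc ∑ j, |(U * V) i j| ≤ ∑ j, ∑ a, |U i a| * |V a j| := Finset.sum_le_sum fun j _ => by
        rw [Matrix.mul_apply]
        refine (Finset.abs_sum_le_sum_abs _ _).trans (le_of_eq ?_)
        simp [abs_mul]
    _ = ∑ a, |U i a| * ∑ j, |V a j| := by
        rw [Finset.sum_comm]; simp [Finset.mul_sum]
    _ ≤ ∑ a, |U i a| * normLinf V := Finset.sum_le_sum fun a _ =>
        mul_le_mul_of_nonneg_left (row_sum_le_normLinf V a) (abs_nonneg _)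
    _ = (∑ a, |U i a|) * normLinf V := by rw [Finset.sum_mul]
    _ ≤ _ := mul_le_mul_of_nonneg_right (row_sum_le_normLinf U i) (normLinf_nonneg _)

lemma normLinf_sub_le [Finite k] [Fintype l] (U V : Matrix k l ℝ) :
    normLinf (U - V) ≤ normLinf U + normLinf V := by
  refine normLinf_le (add_nonneg (normLinf_nonneg _) (normLinf_nonneg _)) fun i => ?_
  calc ∑ j, |(U - V) i j| ≤ ∑ j, (|U i j| + |V i j|) := Finset.sum_le_sum fun j _ => abs_sub _ _
    _ = ∑ j, |U i j| + ∑ j, |V i j| := Finset.sum_add_distrib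
    _ ≤ _ := add_le_add (row_sum_le_normLinf U i) (row_sum_le_normLinf V i)

lemma normL1_eq_normLinf_transpose [Fintype k] (U : Matrix k l ℝ) : normL1 U = normLinf Uᵀ := rfl

lemma abs_mul_apply_le [Finite k] [Fintype l] (U : Matrix k l ℝ) (V : Matrix l m ℝ) {c : ℝ}
    (hV : ∀ i j, |V i j| ≤ c) (hc : 0 ≤ c) (i : k) (j : m) : |(U * V) i j| ≤ normLinf U * c := by
  rw [Matrix.mul_apply]
  exact abs_sum_mul_le_normLinf U (fun a => V a j) (fun a => hV a j) hc i

lemma abs_mul_apply_le' [Finite m] [Fintype l] (U : Matrix k l ℝ) (V : Matrix l m ℝ) {c : ℝ}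
    (hU : ∀ i j, |U i j| ≤ c) (hc : 0 ≤ c) (i : k) (j : m) : |(U * V) i j| ≤ c * normL1 V := by
  have h := abs_mul_apply_le Vᵀ Uᵀ (fun i j => hU j i) hc j i
  rw [← Matrix.transpose_mul, Matrix.transpose_apply] at h
  rwa [normL1_eq_normLinf_transpose, mul_comm]

end Norms

lemma normLinf_pos_of_posDef {k : Type*} [Fintype k] [Nonempty k] {U : Matrix k k ℝ}
    (hU : U.PosDef) : 0 < normLinf U := by
  obtain ⟨i⟩ := ‹Nonempty k›
  calc 0 < |U i i| := abs_pos.mpr hU.diag_pos.ne'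
    _ ≤ ∑ j, |U i j| := Finset.single_le_sum (f := fun j => |U i j|)
        (fun _ _ => abs_nonneg _) (Finset.mem_univ i)
    _ ≤ _ := row_sum_le_normLinf U i

/-! ### Perturbation of the precision matrix -/

/-- After congruence with a factor of `Sg⁻¹`, an eigenvalue `μ ≤ 0` yields a vector `u` with `Sg D u
= (μ - 1) u`. An eigenvalue of modulus at least 1 is incompatible with a row sum norm below 1. -/
lemma posDef_add_of_normLinf_lt {q : ℕ} {Sg D : Matrix (Fin q) (Fin q) ℝ} (hS : Sg.PosDef)
    (hD : Dᵀ = D) (h : normLinf (Sg * D) < 1) : (Sg⁻¹ + D).PosDef := by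
  obtain ⟨C, hC, hTC⟩ := exists_unit_factor hS.inv
  have hCd := (Matrix.isUnit_iff_isUnit_det _).mp hC
  have hSd := (Matrix.isUnit_iff_isUnit_det _).mp hS.isUnit
  have hCt : (C⁻¹)ᵀ = Cᵀ⁻¹ := Matrix.transpose_nonsing_inv C
  have hCi : IsUnit (C⁻¹) := by
    rw [Matrix.isUnit_iff_isUnit_det, Matrix.det_nonsing_inv]
    exact hCd.ringInverse
  have hst : (Sg⁻¹)ᵀ = Sg⁻¹ := by simpa using hS.inv.1.eq
  set N := (C⁻¹)ᵀ * (Sg⁻¹ + D) * C⁻¹ with hN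
  have hNs : N.IsHermitian := by
    have : Nᵀ = N := by
      rw [hN]; simp only [Matrix.transpose_mul, Matrix.transpose_transpose, Matrix.transpose_add,
        hD, hst, Matrix.mul_assoc]
    simpa [Matrix.IsHermitian] using this
  suffices hNp : N.PosDef by
    refine (Matrix.IsUnit.posDef_star_left_conjugate_iff (x := Sg⁻¹ + D) hCi).mp ?_
    simpa [Matrix.star_eq_conjTranspose] using hNp
  rw [hNs.posDef_iff_eigenvalues_pos]
  intro i
  by_contra! hle
  set μ := hNs.eigenvalues i
  set v : Fin q → ℝ := ⇑(hNs.eigenvectorBasis i)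
  have hv : N *ᵥ v = μ • v := hNs.mulVec_eigenvectorBasis i
  have hv0 : v ≠ 0 := by
    intro h0
    have := hNs.eigenvectorBasis.orthonormal.ne_zero i
    exact this (by ext j; exact congrFun h0 j)
  set u := C⁻¹ *ᵥ v
  have hCu : C *ᵥ u = v := by
    rw [Matrix.mulVec_mulVec, Matrix.mul_nonsing_inv _ hCd, Matrix.one_mulVec]
  have hu0 : u ≠ 0 := by
    intro h0; rw [h0, Matrix.mulVec_zero] at hCu; exact hv0 hCu.symm
  have h1 : (Sg⁻¹ + D) *ᵥ u = μ • (Sg⁻¹ *ᵥ u) := by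
    have h2 : Cᵀ *ᵥ (N *ᵥ v) = (Sg⁻¹ + D) *ᵥ u := by
      rw [Matrix.mulVec_mulVec, hN, ← Matrix.mul_assoc, ← Matrix.mul_assoc, hCt,
        Matrix.mul_nonsing_inv _ (by rwa [Matrix.det_transpose]), one_mul, Matrix.mulVec_mulVec]
    rw [← h2, hv, Matrix.mulVec_smul, ← hCu, Matrix.mulVec_mulVec, ← hTC]
  have h3 : (Sg * D) *ᵥ u = (μ - 1) • u := by
    have h4 : D *ᵥ u = (μ - 1) • (Sg⁻¹ *ᵥ u) := by
      rw [Matrix.add_mulVec] at h1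
      rw [sub_smul, one_smul, ← h1]; simp
    rw [← Matrix.mulVec_mulVec, h4, Matrix.mulVec_smul, Matrix.mulVec_mulVec,
      Matrix.mul_nonsing_inv _ hSd, Matrix.one_mulVec]
  obtain ⟨j0, hj0⟩ := Function.ne_iff.mp hu0
  obtain ⟨j, -, hj⟩ := Finset.exists_max_image Finset.univ (fun j => |u j|) ⟨j0, Finset.mem_univ _⟩
  have hpos : 0 < |u j| := (abs_pos.mpr hj0).trans_le (hj j0 (Finset.mem_univ _))
  have h5 := abs_sum_mul_le_normLinf (Sg * D) u (fun a => hj a (Finset.mem_univ _)) hpos.le j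
  have h6 : ∑ a, (Sg * D) j a * u a = (μ - 1) * u j := congrFun h3 j
  rw [h6, abs_mul, abs_of_nonpos (by linarith : μ - 1 ≤ 0)] at h5
  nlinarith

/-- The remainder of the first order expansion of the inverse at `Sg⁻¹`. -/
def invRemainder {q : ℕ} (Sg D : Matrix (Fin q) (Fin q) ℝ) : Matrix (Fin q) (Fin q) ℝ :=
  (Sg⁻¹ + D)⁻¹ - Sg + Sg * D * Sg

/-- With `Y = (Sg⁻¹ + D)⁻¹` one has `Y = Sg - Y D Sg`, so the remainder is exactly `Y D Sg D Sg`,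
and `‖Y‖ ≤ ‖Sg‖ + ‖Y‖ / 3` gives the factor `3 / 2`. One `D` is measured by row sums, the other
entrywise. -/
lemma abs_invRemainder_le {q : ℕ} {Sg D : Matrix (Fin q) (Fin q) ℝ} (hS : Sg.PosDef)
    (hT : (Sg⁻¹ + D).PosDef) {r ρ : ℝ} (hr : ∀ i j, |D i j| ≤ r) (hr0 : 0 ≤ r)
    (hρ : normLinf D ≤ ρ) (hK : normLinf Sg * ρ ≤ 1 / 3) (i j : Fin q) :
    |invRemainder Sg D i j| ≤ 3 / 2 * normLinf Sg ^ 3 * ρ * r := by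
  have hSd := (Matrix.isUnit_iff_isUnit_det _).mp hS.isUnit
  have hTd := (Matrix.isUnit_iff_isUnit_det _).mp hT.isUnit
  have hρ0 : 0 ≤ ρ := (normLinf_nonneg _).trans hρ
  have hK0 := normLinf_nonneg Sg
  set Y := (Sg⁻¹ + D)⁻¹ with hY
  have h1 : Y = Sg - Y * D * Sg := by
    have h : Y * (Sg⁻¹ + D) * Sg = Sg := by rw [hY, Matrix.nonsing_inv_mul _ hTd, one_mul]
    rw [Matrix.mul_add, Matrix.add_mul, Matrix.mul_assoc Y, Matrix.nonsing_inv_mul _ hSd,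
      mul_one] at h
    exact eq_sub_of_add_eq h
  have hYDS : normLinf (Y * D * Sg) ≤ normLinf Y * ρ * normLinf Sg :=
    (normLinf_mul_le _ _).trans <| mul_le_mul_of_nonneg_right
      ((normLinf_mul_le _ _).trans (mul_le_mul_of_nonneg_left hρ (normLinf_nonneg _))) hK0
  have hYn : normLinf Y ≤ 3 / 2 * normLinf Sg := by
    have h2 : normLinf Y ≤ normLinf Sg + normLinf (Y * D * Sg) := by
      conv_lhs => rw [h1]
      exact normLinf_sub_le _ _
    have h3 : normLinf Y * ρ * normLinf Sg ≤ normLinf Y * (1 / 3) := by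
      rw [mul_assoc, mul_comm ρ]
      exact mul_le_mul_of_nonneg_left hK (normLinf_nonneg _)
    linarith
  have hR : invRemainder Sg D = Y * D * Sg * (D * Sg) := by
    have : Y * D * Sg = Sg - Y := by rw [eq_sub_iff_add_eq, add_comm]; exact (eq_sub_iff_add_eq.mp h1)
    have h4 : invRemainder Sg D = Sg * D * Sg - Y * D * Sg := by
      rw [this, invRemainder]; abel
    rw [h4, ← Matrix.sub_mul, ← Matrix.sub_mul, ← this]
    simp only [Matrix.mul_assoc]
  have hsym : normL1 Sg = normLinf Sg := by
    rw [normL1_eq_normLinf_transpose]; congr 1; simpa using hS.1.eq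
  rw [hR]
  have h5 : ∀ a b, |(D * Sg) a b| ≤ r * normLinf Sg := fun a b => by
    rw [← hsym]; exact abs_mul_apply_le' D Sg hr hr0 a b
  refine (abs_mul_apply_le _ _ h5 (by positivity) i j).trans ?_
  have h6 : normLinf (Y * D * Sg) ≤ 3 / 2 * normLinf Sg * ρ * normLinf Sg := by
    refine hYDS.trans ?_
    gcongr
  calc normLinf (Y * D * Sg) * (r * normLinf Sg)
      ≤ 3 / 2 * normLinf Sg * ρ * normLinf Sg * (r * normLinf Sg) := by gcongr
    _ = _ := by ring

lemma continuousAt_inv_of_posDef {q : ℕ} {T : Matrix (Fin q) (Fin q) ℝ} (hT : T.PosDef) :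
    ContinuousAt (fun X : Matrix (Fin q) (Fin q) ℝ => X⁻¹) T := by
  have : (fun X : Matrix (Fin q) (Fin q) ℝ => X⁻¹) = fun X => (X.det)⁻¹ • X.adjugate := by
    ext1 X; rw [Matrix.inv_def, Ring.inverse_eq_inv']
  rw [this]
  have h1 : ContinuousAt (fun X : Matrix (Fin q) (Fin q) ℝ => X.det) T :=
    (continuous_id.matrix_det).continuousAt
  exact (h1.inv₀ hT.det_pos.ne').smul (continuous_id.matrix_adjugate).continuousAt

lemma continuous_frob {q : ℕ} (D : Matrix (Fin q) (Fin q) ℝ) :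
    Continuous fun X : Matrix (Fin q) (Fin q) ℝ => frob X D := by
  unfold frob; fun_prop

/-- First order condition for a minimum of the loss along a segment. -/
lemma frob_nonneg_of_min {q : ℕ} {S T D : Matrix (Fin q) (Fin q) ℝ} (hT : T.PosDef)
    (h : ∀ s ∈ Set.Ioc (0 : ℝ) 1, (T + s • D).PosDef ∧ loss S T ≤ loss S (T + s • D)) :
    0 ≤ frob (S - T⁻¹) D := by
  have hlim : Tendsto (fun s : ℝ => frob (S - (T + s • D)⁻¹) D) (𝓝[>] 0)
      (𝓝 (frob (S - T⁻¹) D)) := by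
    have h0 : Tendsto (fun s : ℝ => T + s • D) (𝓝[>] 0) (𝓝 T) := by
      have : Continuous fun s : ℝ => T + s • D := by fun_prop
      have h2 := this.tendsto 0
      simp only [zero_smul, add_zero] at h2
      exact h2.mono_left nhdsWithin_le_nhds
    have h1 := (continuousAt_inv_of_posDef hT).tendsto.comp h0
    exact ((continuous_frob D).tendsto _).comp (tendsto_const_nhds.sub h1)
  refine ge_of_tendsto hlim ?_
  filter_upwards [Ioc_mem_nhdsGT (zero_lt_one' ℝ)] with s hs
  obtain ⟨hp, hl⟩ := h s hs
  -- The tangent is taken at the moved point and evaluated back at `T`, so continuity of the inverse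
  -- suffices and `log det` is never differentiated.
  have h3 := loss_tangent_le S hp hT
  have h4 : T - (T + s • D) = (-s) • D := by rw [neg_smul]; abel
  rw [h4, frob_smul_right] at h3
  have : 0 ≤ s * frob (S - (T + s • D)⁻¹) D := by linarith
  exact nonneg_of_mul_nonneg_right this hs.1

/-! ### The oracle estimator -/

lemma mem_supp {q : ℕ} {Th : Matrix (Fin q) (Fin q) ℝ} {e : Fin q × Fin q} :
    e ∈ supp Th ↔ Th e.1 e.2 ≠ 0 := by simp [supp]

lemma notMem_supp {q : ℕ} {Th : Matrix (Fin q) (Fin q) ℝ} {e : Fin q × Fin q} :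
    e ∉ supp Th ↔ Th e.1 e.2 = 0 := by simp [supp]

lemma swap_mem_supp {q : ℕ} {Th : Matrix (Fin q) (Fin q) ℝ} (h : Thᵀ = Th) {e : Fin q × Fin q} :
    e.swap ∈ supp Th ↔ e ∈ supp Th := by
  rw [mem_supp, mem_supp]
  have : Th e.2 e.1 = Th e.1 e.2 := congrFun (congrFun h e.1) e.2
  simp [this]

lemma normLinf_le_of_supp {q : ℕ} {Th D : Matrix (Fin q) (Fin q) ℝ} {r : ℝ} (hr : 0 ≤ r)
    (hD : ∀ e ∉ supp Th, D e.1 e.2 = 0) (hDr : ∀ i j, |D i j| ≤ r) :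
    normLinf D ≤ maxDegree Th * r := by
  refine normLinf_le (by positivity) fun i => ?_
  calc ∑ j, |D i j| = ∑ j ∈ Finset.univ.filter (fun k => Th i k ≠ 0), |D i j| := by
        symm
        refine Finset.sum_subset (Finset.filter_subset _ _) fun j _ hj => ?_
        simp only [Finset.mem_filter, Finset.mem_univ, true_and, not_not] at hj
        rw [hD (i, j) (notMem_supp.mpr hj), abs_zero]
    _ ≤ ∑ _j ∈ Finset.univ.filter (fun k => Th i k ≠ 0), r :=
        Finset.sum_le_sum fun j _ => hDr i j
    _ = ((Finset.univ.filter (fun k => Th i k ≠ 0)).card : ℝ) * r := by simp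
    _ ≤ _ := by
        refine mul_le_mul_of_nonneg_right ?_ hr
        exact_mod_cast Finset.le_sup (f := fun j => (Finset.univ.filter fun k => Th j k ≠ 0).card)
          (Finset.mem_univ i)

/-- The entries of a matrix indexed by a set of positions. -/
def entries {q : ℕ} (A : Finset (Fin q × Fin q)) (D : Matrix (Fin q) (Fin q) ℝ) : A → ℝ :=
  fun e => D e.1.1 e.1.2

/-- The identity `(Σ ⊗ Σ) vec D = vec (Σ D Σ)`; restricting the columns to `A` loses nothing because
`D` vanishes elsewhere. -/
lemma hessBlock_mulVec_entries {q : ℕ} {Sg D : Matrix (Fin q) (Fin q) ℝ} (hS : Sgᵀ = Sg)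
    {A : Finset (Fin q × Fin q)} (B : Finset (Fin q × Fin q))
    (hD : ∀ e ∉ A, D e.1 e.2 = 0) : hessBlock Sg B A *ᵥ entries A D = entries B (Sg * D * Sg) := by
  ext ⟨⟨i, j⟩, he⟩
  simp only [Matrix.mulVec, dotProduct, hessBlock, hess, entries, Matrix.submatrix_apply,
    Matrix.kroneckerMap_apply]
  rw [Finset.sum_coe_sort A (fun x : Fin q × Fin q => Sg i x.1 * Sg j x.2 * D x.1 x.2),
    Finset.sum_subset (Finset.subset_univ A) (fun x _ hx => by rw [hD x hx, mul_zero]),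
    Fintype.sum_prod_type, Finset.sum_comm, Matrix.mul_apply]
  refine Finset.sum_congr rfl fun l _ => ?_
  rw [Matrix.mul_apply, Finset.sum_mul]
  refine Finset.sum_congr rfl fun k _ => ?_
  have : Sg l j = Sg j l := congrFun (congrFun hS j) l
  rw [this]; ring

lemma posDef_hessBlock {q : ℕ} {Sg : Matrix (Fin q) (Fin q) ℝ} (hS : Sg.PosDef)
    (A : Finset (Fin q × Fin q)) : (hessBlock Sg A A).PosDef :=
  (hS.kronecker hS).submatrix Subtype.val_injective

/-- Symmetric perturbations supported on `A` with entries bounded by `r`. -/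
def perturbations {q : ℕ} (A : Finset (Fin q × Fin q)) (r : ℝ) :
    Set (Matrix (Fin q) (Fin q) ℝ) :=
  {D | Dᵀ = D ∧ (∀ e ∉ A, D e.1 e.2 = 0) ∧ ∀ i j, |D i j| ≤ r}

lemma isCompact_perturbations {q : ℕ} (A : Finset (Fin q × Fin q)) (r : ℝ) :
    IsCompact (perturbations A r) := by
  have hK : IsCompact {D : Matrix (Fin q) (Fin q) ℝ | ∀ i j, D i j ∈ Set.Icc (-r) r} := by
    have h : IsCompact
        (Set.univ.pi fun _ : Fin q => Set.univ.pi fun _ : Fin q => Set.Icc (-r) r) :=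
      isCompact_univ_pi fun _ => isCompact_univ_pi fun _ => isCompact_Icc
    convert! h using 1
    exact Set.ext fun D => ⟨fun h i _ j _ => h i j, fun h i j => h i trivial j trivial⟩
  have h1 : IsClosed {D : Matrix (Fin q) (Fin q) ℝ | Dᵀ = D} :=
    isClosed_eq (by fun_prop) continuous_id
  have h2 : IsClosed {D : Matrix (Fin q) (Fin q) ℝ | ∀ e ∉ A, D e.1 e.2 = 0} := by
    simp only [Set.ofPred_forall]
    exact isClosed_iInter fun e => isClosed_iInter fun _ =>
      isClosed_eq (by fun_prop) continuous_const
  convert! (hK.inter_left h2).inter_left h1 using 1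
  exact Set.ext fun D => ⟨fun h => ⟨h.1, h.2.1, fun i j => abs_le.mp (h.2.2 i j)⟩,
    fun h => ⟨h.1, h.2.1, fun i j => abs_le.mpr (h.2.2 i j)⟩⟩

lemma convex_perturbations {q : ℕ} (A : Finset (Fin q × Fin q)) (r : ℝ) :
    Convex ℝ (perturbations A r) := by
  rintro D ⟨h1, h2, h3⟩ D' ⟨h1', h2', h3'⟩ a b ha hb hab
  refine ⟨?_, fun e he => ?_, fun i j => ?_⟩
  · rw [Matrix.transpose_add, Matrix.transpose_smul, Matrix.transpose_smul, h1, h1']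
  · simp [h2 e he, h2' e he]
  · calc |(a • D + b • D') i j| ≤ |a * D i j| + |b * D' i j| := abs_add_le _ _
      _ = a * |D i j| + b * |D' i j| := by rw [abs_mul, abs_mul, abs_of_nonneg ha, abs_of_nonneg hb]
      _ ≤ a * r + b * r := add_le_add (mul_le_mul_of_nonneg_left (h3 i j) ha)
          (mul_le_mul_of_nonneg_left (h3' i j) hb)
      _ = r := by rw [← add_mul, hab, one_mul]

lemma K1_nonneg {q : ℕ} (Sg : Matrix (Fin q) (Fin q) ℝ) : 0 ≤ K1 Sg := normLinf_nonneg _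

lemma K2_nonneg {q : ℕ} (Sg : Matrix (Fin q) (Fin q) ℝ) : 0 ≤ K2 Sg := normLinf_nonneg _

lemma K3_nonneg {q : ℕ} (Sg : Matrix (Fin q) (Fin q) ℝ) : 0 ≤ K3 Sg := normLinf_nonneg _

/-- The gradient of the loss at `Sg⁻¹ + D` in terms of the noise, the Hessian and the remainder. -/
lemma gradient_eq {q : ℕ} (S Sg D : Matrix (Fin q) (Fin q) ℝ) :
    S - (Sg⁻¹ + D)⁻¹ = (S - Sg) + Sg * D * Sg - invRemainder Sg D := by
  rw [invRemainder]; abel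

/-- Allows a symmetric gradient to be tested against a direction not known to be symmetric. -/
lemma frob_symmetrize {q : ℕ} {G D : Matrix (Fin q) (Fin q) ℝ} (hG : Gᵀ = G) :
    frob G ((1 / 2 : ℝ) • (D + Dᵀ)) = frob G D := by
  rw [frob_smul_right, frob_add_right, frob_transpose, hG]; ring

lemma frob_eq_dotProduct {q : ℕ} {G D : Matrix (Fin q) (Fin q) ℝ} {A : Finset (Fin q × Fin q)}
    (hD : ∀ e ∉ A, D e.1 e.2 = 0) : frob G D = entries A G ⬝ᵥ entries A D := by
  simp only [frob, dotProduct, entries]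
  rw [Finset.sum_coe_sort A (fun e : Fin q × Fin q => G e.1 e.2 * D e.1 e.2)]
  exact (Finset.sum_subset (Finset.subset_univ A) fun e _ he => by rw [hD e he, mul_zero]).symm

/-- Under the stated bounds on the noise `S - Sg` on the support of the precision matrix, the
restricted likelihood equations have a solution close to the precision matrix. -/
theorem exists_restricted_stationary {q : ℕ} {S Sg : Matrix (Fin q) (Fin q) ℝ} (hSg : Sg.PosDef)
    (hS : Sᵀ = S) {t : ℝ} (ht : 0 ≤ t)
    (hW : ∀ e ∈ supp Sg⁻¹, |(S - Sg) e.1 e.2| ≤ t)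
    (ht1 : 6 * K1 Sg * K2 Sg * maxDegree Sg⁻¹ * t ≤ 1)
    (ht2 : 6 * K1 Sg ^ 3 * K2 Sg ^ 2 * maxDegree Sg⁻¹ * t ≤ 1) :
    ∃ T : Matrix (Fin q) (Fin q) ℝ, T.PosDef ∧ (∀ e ∉ supp Sg⁻¹, T e.1 e.2 = 0) ∧
      (∀ e ∈ supp Sg⁻¹, (S - T⁻¹) e.1 e.2 = 0) ∧
      (∀ i j, |(T - Sg⁻¹) i j| ≤ 2 * K2 Sg * t) ∧
      ∀ e ∉ supp Sg⁻¹, |(S - T⁻¹) e.1 e.2| ≤ |(S - Sg) e.1 e.2| + (2 * K3 Sg + 1) * t := by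
  have hSgt : Sgᵀ = Sg := by simpa using hSg.1.eq
  have hTht : (Sg⁻¹)ᵀ = Sg⁻¹ := by simpa using hSg.inv.1.eq
  set A := supp Sg⁻¹ with hA
  set d : ℝ := (maxDegree Sg⁻¹ : ℝ) with hd
  have hd0 : 0 ≤ d := by positivity
  -- Noise and remainder contribute at most `t` each, and the inverse Hessian block amplifies by
  -- `K₂`; with this radius the box below contains the test point used later.
  set r : ℝ := 2 * K2 Sg * t with hrdef
  have hK1 := K1_nonneg Sg
  have hK2 := K2_nonneg Sg
  have hK3 := K3_nonneg Sg
  have hr : 0 ≤ r := by positivity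
  have hKρ : normLinf Sg * (d * r) ≤ 1 / 3 := by
    have : normLinf Sg * (d * r) = (6 * K1 Sg * K2 Sg * d * t) / 3 := by rw [hrdef, K1]; ring
    rw [this]; linarith
  have hnorm : ∀ D ∈ perturbations A r, normLinf D ≤ d * r := fun D hD =>
    normLinf_le_of_supp hr hD.2.1 hD.2.2
  have hPD : ∀ D ∈ perturbations A r, (Sg⁻¹ + D).PosDef := fun D hD => by
    refine posDef_add_of_normLinf_lt hSg hD.1 ?_
    calc normLinf (Sg * D) ≤ normLinf Sg * normLinf D := normLinf_mul_le _ _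
      _ ≤ normLinf Sg * (d * r) := mul_le_mul_of_nonneg_left (hnorm D hD) (normLinf_nonneg _)
      _ < 1 := by linarith
  have hRem : ∀ D ∈ perturbations A r, ∀ i j, |invRemainder Sg D i j| ≤ t := fun D hD i j => by
    refine (abs_invRemainder_le hSg (hPD D hD) hD.2.2 hr (hnorm D hD) hKρ i j).trans ?_
    calc 3 / 2 * normLinf Sg ^ 3 * (d * r) * r
        = (6 * K1 Sg ^ 3 * K2 Sg ^ 2 * d * t) * t := by rw [hrdef, K1]; ring
      _ ≤ 1 * t := mul_le_mul_of_nonneg_right ht2 ht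
      _ = t := one_mul t
  have hzero : (0 : Matrix (Fin q) (Fin q) ℝ) ∈ perturbations A r :=
    ⟨by simp, by simp, fun i j => by simpa using hr⟩
  have hcont : ContinuousOn (fun D => loss S (Sg⁻¹ + D)) (perturbations A r) := by
    intro D hD
    have hdet : Continuous fun D : Matrix (Fin q) (Fin q) ℝ => (Sg⁻¹ + D).det := by fun_prop
    have htr : Continuous fun D : Matrix (Fin q) (Fin q) ℝ => ((Sg⁻¹ + D)ᵀ * S).trace := by fun_prop
    have hlog := (hdet.continuousAt (x := D)).log (hPD D hD).det_pos.ne'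
    exact (hlog.neg.add htr.continuousAt).continuousWithinAt
  -- The minimizer may lie on the boundary of the box, so only a variational inequality is available
  -- at first.
  obtain ⟨m, hm, hmin⟩ := (isCompact_perturbations A r).exists_isMinOn ⟨0, hzero⟩ hcont
  set T := Sg⁻¹ + m with hT
  set G := S - T⁻¹ with hG
  have hTt : Tᵀ = T := by rw [hT, Matrix.transpose_add, hTht, hm.1]
  have hGt : Gᵀ = G := by
    rw [hG, Matrix.transpose_sub, hS, Matrix.transpose_nonsing_inv, hTt]
  have hfirst : ∀ D ∈ perturbations A r, 0 ≤ frob G (D - m) := fun D hD => by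
    refine frob_nonneg_of_min (hPD m hm) fun s hs => ?_
    have hmem : m + s • (D - m) ∈ perturbations A r :=
      (convex_perturbations A r).add_smul_sub_mem hm hD ⟨hs.1.le, hs.2⟩
    rw [hT, add_assoc]
    exact ⟨hPD _ hmem, hmin hmem⟩
  set H := hessBlock Sg A A with hH
  have hHpd : H.PosDef := posDef_hessBlock hSg A
  have hHdet := (Matrix.isUnit_iff_isUnit_det _).mp hHpd.isUnit
  have hGeq : G = (S - Sg) + Sg * m * Sg - invRemainder Sg m := gradient_eq S Sg m
  set w : A → ℝ := entries A ((S - Sg) - invRemainder Sg m) with hw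
  have hwbound : ∀ e, |w e| ≤ 2 * t := fun e => by
    calc |w e| ≤ |(S - Sg) e.1.1 e.1.2| + |invRemainder Sg m e.1.1 e.1.2| := abs_sub _ _
      _ ≤ t + t := add_le_add (hW e.1 e.2) (hRem m hm _ _)
      _ = 2 * t := by ring
  have hGA : entries A G = H *ᵥ entries A m + w := by
    rw [hH, hessBlock_mulVec_entries hSgt A hm.2.1, hGeq]
    ext e; simp only [entries, hw, Matrix.sub_apply, Matrix.add_apply, Pi.add_apply]; ring
  set z : A → ℝ := H⁻¹ *ᵥ w with hz
  have hHG : H⁻¹ *ᵥ entries A G = entries A m + z := by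
    rw [hGA, Matrix.mulVec_add, Matrix.mulVec_mulVec, Matrix.nonsing_inv_mul _ hHdet,
      Matrix.one_mulVec]
  have hzbound : ∀ e, |z e| ≤ r := fun e => by
    refine (abs_sum_mul_le_normLinf H⁻¹ w hwbound (by positivity) e).trans (le_of_eq ?_)
    rw [hrdef, K2]; ring
  -- The test point is the Newton type update `-H⁻¹ w`: seen from `m`, it points in the direction
  -- `-H⁻¹ g`, with `g` the gradient on `A`.
  set D' : Matrix (Fin q) (Fin q) ℝ :=
    Matrix.of fun i j => if h : (i, j) ∈ A then -z ⟨(i, j), h⟩ else 0 with hD'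
  have hD'A : ∀ e ∉ A, D' e.1 e.2 = 0 := fun e he => by
    simp only [hD', Matrix.of_apply]; exact dif_neg he
  have hD'e : entries A D' = -z := by
    ext ⟨e, he⟩
    simp only [entries, hD', Matrix.of_apply]
    exact dif_pos he
  have hD'r : ∀ i j, |D' i j| ≤ r := fun i j => by
    by_cases h : (i, j) ∈ A
    · have : D' i j = -z ⟨(i, j), h⟩ := congrFun hD'e ⟨(i, j), h⟩
      rw [this, abs_neg]; exact hzbound _
    · rw [hD'A (i, j) h, abs_zero]; exact hr
  have hD'' : (1 / 2 : ℝ) • (D' + D'ᵀ) ∈ perturbations A r := by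
    refine ⟨?_, fun e he => ?_, fun i j => ?_⟩
    · rw [Matrix.transpose_smul, Matrix.transpose_add, Matrix.transpose_transpose, add_comm]
    · have he' : D' e.2 e.1 = 0 := hD'A e.swap (fun h => he ((swap_mem_supp hTht).mp h))
      simp [hD'A e he, he']
    · have : |D' i j + D' j i| ≤ r + r :=
        (abs_add_le _ _).trans (add_le_add (hD'r i j) (hD'r j i))
      simp only [Matrix.smul_apply, Matrix.add_apply, Matrix.transpose_apply, smul_eq_mul, abs_mul]
      rw [abs_of_pos (by norm_num : (0 : ℝ) < 1 / 2)]; linarith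
  have hquad := hfirst _ hD''
  rw [frob_sub_right, frob_symmetrize hGt, ← frob_sub_right,
    frob_eq_dotProduct (A := A) (fun e he => by simp [hD'A e he, hm.2.1 e he])] at hquad
  have hent : entries A (D' - m) = -(H⁻¹ *ᵥ entries A G) := by
    have : entries A (D' - m) = entries A D' - entries A m := rfl
    rw [this, hD'e, hHG]; abel
  rw [hent, dotProduct_neg] at hquad
  -- The variational inequality now reads `0 ≤ -gᵀ H⁻¹ g`, which forces `g = 0` since `H⁻¹` is
  -- positive definite.
  have hg0 : entries A G = 0 := by
    by_contra hne
    have := hHpd.inv.dotProduct_mulVec_pos hne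
    simp only [star_trivial] at this
    linarith
  have hmz : entries A m = -z := by
    rw [hg0, Matrix.mulVec_zero] at hHG
    exact eq_neg_of_add_eq_zero_left hHG.symm
  have hTm : T - Sg⁻¹ = m := by rw [hT]; abel
  refine ⟨T, hPD m hm, fun e he => ?_, fun e he => congrFun hg0 ⟨e, he⟩, fun i j => ?_,
    fun e he => ?_⟩
  · rw [hT, Matrix.add_apply, notMem_supp.mp he, hm.2.1 e he, add_zero]
  · rw [hTm]; exact hm.2.2 i j
  · have hec : e ∈ Aᶜ := Finset.mem_compl.mpr he
    -- On `A` the perturbation equals `-H⁻¹ w`, so off `A` the linear term is governed by the matrix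
    -- whose norm is `K₃`.
    have h1 : (Sg * m * Sg) e.1 e.2
        = -∑ a, (hessBlock Sg Aᶜ A * H⁻¹) ⟨e, hec⟩ a * w a := by
      have h2 := congrFun (hessBlock_mulVec_entries hSgt Aᶜ hm.2.1) ⟨e, hec⟩
      rw [hmz, hz, Matrix.mulVec_neg, Matrix.mulVec_mulVec] at h2
      exact h2.symm
    have h3 : |(Sg * m * Sg) e.1 e.2| ≤ K3 Sg * (2 * t) := by
      rw [h1, abs_neg]
      exact abs_sum_mul_le_normLinf _ w hwbound (by positivity) _
    have h4 := hRem m hm e.1 e.2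
    have h5 : (S - T⁻¹) e.1 e.2
        = (S - Sg) e.1 e.2 + (Sg * m * Sg) e.1 e.2 - invRemainder Sg m e.1 e.2 :=
      congrFun (congrFun hGeq e.1) e.2
    rw [h5]
    calc _ ≤ |(S - Sg) e.1 e.2| + |(Sg * m * Sg) e.1 e.2| + |invRemainder Sg m e.1 e.2| :=
          (abs_sub _ _).trans (add_le_add_left (abs_add_le _ _) _)
      _ ≤ _ := by linarith

/-! ### The CLIME estimator -/

lemma entryMax_le_iff {q : ℕ} {U : Matrix (Fin q) (Fin q) ℝ} {c : ℝ} (hc : 0 ≤ c) :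
    entryMax U ≤ c ↔ ∀ i j, |U i j| ≤ c :=
  ⟨fun h i j => (le_ciSup (f := fun e : Fin q × Fin q => |U e.1 e.2|)
    (Set.finite_range _).bddAbove (i, j)).trans h, fun h => Real.iSup_le (fun e => h e.1 e.2) hc⟩

/-- Only competitors with norm at most that of the given feasible point matter, and they lie in a
compact box. -/
lemma exists_isClime {q : ℕ} {S Th : Matrix (Fin q) (Fin q) ℝ} {c : ℝ} (hc : 0 ≤ c)
    (hTh : entryMax (S * Th - 1) ≤ c) : ∃ T, IsClime S c T := by
  set F : Set (Matrix (Fin q) (Fin q) ℝ) := {X | entryMax (S * X - 1) ≤ c} with hF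
  have hFc : IsClosed F := by
    have : F = {X | ∀ i j, |(S * X - 1) i j| ≤ c} := Set.ext fun X => entryMax_le_iff hc
    rw [this]
    simp only [Set.ofPred_forall]
    exact isClosed_iInter fun i => isClosed_iInter fun j =>
      isClosed_le (by fun_prop) continuous_const
  set b := entryL1 Th with hb
  have hK : IsCompact {X : Matrix (Fin q) (Fin q) ℝ | ∀ i j, X i j ∈ Set.Icc (-b) b} := by
    have h : IsCompact
        (Set.univ.pi fun _ : Fin q => Set.univ.pi fun _ : Fin q => Set.Icc (-b) b) :=
      isCompact_univ_pi fun _ => isCompact_univ_pi fun _ => isCompact_Icc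
    convert! h using 1
    exact Set.ext fun D => ⟨fun h i _ j _ => h i j, fun h i j => h i trivial j trivial⟩
  have hentry : ∀ (X : Matrix (Fin q) (Fin q) ℝ) i j, |X i j| ≤ entryL1 X := fun X i j =>
    (Finset.single_le_sum (f := fun j => |X i j|) (fun _ _ => abs_nonneg _)
      (Finset.mem_univ j)).trans
      (Finset.single_le_sum (f := fun i => ∑ j, |X i j|)
        (fun _ _ => Finset.sum_nonneg fun _ _ => abs_nonneg _) (Finset.mem_univ i))
  have hcont : Continuous (entryL1 : Matrix (Fin q) (Fin q) ℝ → ℝ) := by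
    unfold entryL1; fun_prop
  obtain ⟨T, hT, hmin⟩ := (hK.inter_left hFc).exists_isMinOn
    ⟨Th, hTh, fun i j => abs_le.mp (hentry Th i j)⟩ hcont.continuousOn
  refine ⟨T, hT.1, fun X hX => ?_⟩
  by_cases hXb : entryL1 X ≤ b
  · exact hmin ⟨hX, fun i j => abs_le.mp ((hentry X i j).trans hXb)⟩
  · have h1 : entryL1 T ≤ entryL1 Th := hmin ⟨hTh, fun i j => abs_le.mp (hentry Th i j)⟩
    exact h1.trans (not_le.mp hXb).le

/-- The CLIME problem decouples over the columns. -/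
lemma IsClime.col_sum_le {q : ℕ} {S T Th : Matrix (Fin q) (Fin q) ℝ} {c : ℝ} (hc : 0 ≤ c)
    (hT : IsClime S c T) (hTh : entryMax (S * Th - 1) ≤ c) (j : Fin q) :
    ∑ i, |T i j| ≤ ∑ i, |Th i j| := by
  -- Constraint and objective both split over columns, so exchanging a single column keeps
  -- feasibility.
  set X := T.updateCol j (fun i => Th i j) with hX
  have hfeas : entryMax (S * X - 1) ≤ c := by
    rw [entryMax_le_iff hc]
    intro i k
    by_cases hk : k = j
    · subst hk
      have : (S * X - 1) i k = (S * Th - 1) i k := by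
        simp [hX, Matrix.mul_apply]
      rw [this]
      exact (entryMax_le_iff hc).mp hTh i k
    · have : (S * X - 1) i k = (S * T - 1) i k := by
        simp [hX, Matrix.mul_apply, hk]
      rw [this]
      exact (entryMax_le_iff hc).mp hT.1 i k
  have hle : entryL1 T ≤ entryL1 X := hT.2 hfeas
  unfold entryL1 at hle
  rw [Finset.sum_comm, Finset.sum_comm (f := fun i k => |X i k|),
    ← Finset.add_sum_erase _ _ (Finset.mem_univ j),
    ← Finset.add_sum_erase _ (fun k => ∑ i, |X i k|) (Finset.mem_univ j)] at hle
  have h1 : ∑ k ∈ Finset.univ.erase j, ∑ i, |X i k| = ∑ k ∈ Finset.univ.erase j, ∑ i, |T i k| :=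
    Finset.sum_congr rfl fun k hk => by
      simp [hX, Finset.ne_of_mem_erase hk]
  have h2 : ∑ i, |X i j| = ∑ i, |Th i j| := by simp [hX]
  rw [h1, h2] at hle
  linarith

section ClimeError

variable {q : ℕ} {S Sg T : Matrix (Fin q) (Fin q) ℝ} {c : ℝ}

/-- The true precision matrix is feasible because `S Sg⁻¹ - 1 = (S - Sg) Sg⁻¹`. -/
lemma entryMax_mul_inv_sub_one_le (hSg : Sg.PosDef) (hL : 0 < normL1 Sg⁻¹) (hc : 0 < c)
    (hW : ∀ i j, |(S - Sg) i j| ≤ c / normL1 Sg⁻¹) : entryMax (S * Sg⁻¹ - 1) ≤ c := by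
  have hSd := (Matrix.isUnit_iff_isUnit_det _).mp hSg.isUnit
  rw [entryMax_le_iff hc.le]
  intro i j
  have h1 : S * Sg⁻¹ - 1 = (S - Sg) * Sg⁻¹ := by
    rw [Matrix.sub_mul, Matrix.mul_nonsing_inv _ hSd]
  rw [h1]
  refine (abs_mul_apply_le' _ _ hW (by positivity) i j).trans (le_of_eq ?_)
  field_simp

/-- Write `T - Sg⁻¹ = Sg⁻¹ (Sg T - 1)` and `Sg T - 1 = (S T - 1) - (S - Sg) T`. Both terms are at
most `c`, the second since the column sums of `T` do not exceed `L`. -/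
lemma IsClime.abs_sub_inv_le (hSg : Sg.PosDef) (hL : 0 < normL1 Sg⁻¹) (hc : 0 < c)
    (hW : ∀ i j, |(S - Sg) i j| ≤ c / normL1 Sg⁻¹) (hT : IsClime S c T) (i j : Fin q) :
    |(T - Sg⁻¹) i j| ≤ 2 * normL1 Sg⁻¹ * c := by
  have hSd := (Matrix.isUnit_iff_isUnit_det _).mp hSg.isUnit
  have hTht : (Sg⁻¹)ᵀ = Sg⁻¹ := by simpa using hSg.inv.1.eq
  have hTL : normL1 T ≤ normL1 Sg⁻¹ := Real.iSup_le (fun k =>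
    (hT.col_sum_le hc.le (entryMax_mul_inv_sub_one_le hSg hL hc hW) k).trans
      (row_sum_le_normLinf (Sg⁻¹)ᵀ k)) hL.le
  have h1 : ∀ a b, |(Sg * T - 1) a b| ≤ 2 * c := fun a b => by
    have h2 : Sg * T - 1 = (S * T - 1) - (S - Sg) * T := by rw [Matrix.sub_mul]; abel
    have h3 : |((S - Sg) * T) a b| ≤ c := by
      refine (abs_mul_apply_le' _ _ hW (by positivity) a b).trans ?_
      calc c / normL1 Sg⁻¹ * normL1 T ≤ c / normL1 Sg⁻¹ * normL1 Sg⁻¹ := by gcongr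
        _ = c := by field_simp
    have h4 := (entryMax_le_iff hc.le).mp hT.1 a b
    rw [h2, Matrix.sub_apply]
    exact (abs_sub _ _).trans (by linarith)
  have h5 : T - Sg⁻¹ = Sg⁻¹ * (Sg * T - 1) := by
    rw [Matrix.mul_sub, ← Matrix.mul_assoc, Matrix.nonsing_inv_mul _ hSd, one_mul, mul_one]
  have h6 : normLinf Sg⁻¹ = normL1 Sg⁻¹ := by rw [normL1_eq_normLinf_transpose, hTht]
  rw [h5]
  refine (abs_mul_apply_le _ _ h1 (by positivity) i j).trans (le_of_eq ?_)
  rw [h6]; ring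

end ClimeError

/-! ### Uniqueness of the oracle and of the LLA steps -/

section Step

variable {q : ℕ} {S T : Matrix (Fin q) (Fin q) ℝ} {A : Finset (Fin q × Fin q)}

/-- The gradient at `T` vanishes on `A` and admissible differences vanish off `A`, so the linear
term of the tangent inequality is zero. -/
lemma isOracle_iff_eq (hT : T.PosDef) (hTA : ∀ e ∉ A, T e.1 e.2 = 0)
    (hG : ∀ e ∈ A, (S - T⁻¹) e.1 e.2 = 0) (U : Matrix (Fin q) (Fin q) ℝ) :
    IsOracle S A U ↔ U = T := by
  have h0 : ∀ U : Matrix (Fin q) (Fin q) ℝ, (∀ e ∉ A, U e.1 e.2 = 0) →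
      frob (S - T⁻¹) (U - T) = 0 := fun U hU => Finset.sum_eq_zero fun e _ => by
    by_cases he : e ∈ A
    · rw [hG e he, zero_mul]
    · rw [Matrix.sub_apply U, hU e he, hTA e he, sub_zero, mul_zero]
  constructor
  · rintro ⟨⟨hU, hUA⟩, hmin⟩
    refine eq_of_loss_le_tangent S hT hU ?_
    rw [h0 U hUA, add_zero]
    exact hmin ⟨hT, hTA⟩
  · rintro rfl
    refine ⟨⟨hT, hTA⟩, fun V hV => ?_⟩
    have := loss_tangent_le S hT hV.1
    rwa [h0 V hV.2, add_zero] at this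

/-- If the weights vanish on the support of the oracle and dominate the gradient of the loss off
the support, the reweighted problem is solved by the oracle only. -/
lemma isLLAStep_iff_eq {P : ℝ → ℝ} {Th₀ : Matrix (Fin q) (Fin q) ℝ} (hT : T.PosDef)
    (hdiag : ∀ i, (i, i) ∈ A) (hTA : ∀ e ∉ A, T e.1 e.2 = 0)
    (hG : ∀ e ∈ A, (S - T⁻¹) e.1 e.2 = 0)
    (hw : ∀ e ∈ A, e.1 ≠ e.2 → penDeriv P |Th₀ e.1 e.2| = 0)
    (hw' : ∀ e ∉ A, |(S - T⁻¹) e.1 e.2| ≤ penDeriv P |Th₀ e.1 e.2|)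
    (U : Matrix (Fin q) (Fin q) ℝ) : IsLLAStep P S Th₀ U ↔ U = T := by
  -- After cancelling the losses: minus the gradient at `T` is a subgradient of the weighted
  -- penalty. The unpenalized diagonal is harmless because it lies in `A`.
  have key : ∀ U : Matrix (Fin q) (Fin q) ℝ,
      llaObjective P S Th₀ T + loss S U ≤
        llaObjective P S Th₀ U + loss S T + frob (S - T⁻¹) (U - T) := fun U => by
    unfold llaObjective frob
    rw [Finset.sum_filter, Finset.sum_filter]
    have : ∑ e : Fin q × Fin q,
          (if e.1 ≠ e.2 then penDeriv P |Th₀ e.1 e.2| * |T e.1 e.2| else 0) ≤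
        ∑ e : Fin q × Fin q,
          ((if e.1 ≠ e.2 then penDeriv P |Th₀ e.1 e.2| * |U e.1 e.2| else 0) +
            (S - T⁻¹) e.1 e.2 * (U - T) e.1 e.2) := by
      refine Finset.sum_le_sum fun e _ => ?_
      by_cases he : e ∈ A
      · rw [hG e he, zero_mul, add_zero]
        split_ifs with hne
        · rw [hw e he hne, zero_mul, zero_mul]
        · exact le_rfl
      · have hne : e.1 ≠ e.2 := fun h => he (by
          have := hdiag e.1
          rwa [show e = (e.1, e.1) from Prod.ext rfl h.symm])
        rw [if_pos hne, if_pos hne, Matrix.sub_apply U, hTA e he, abs_zero, mul_zero, sub_zero]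
        have h1 := mul_le_mul_of_nonneg_right (hw' e he) (abs_nonneg (U e.1 e.2))
        rw [← abs_mul] at h1
        linarith [neg_abs_le ((S - T⁻¹) e.1 e.2 * U e.1 e.2)]
    rw [Finset.sum_add_distrib] at this
    linarith
  constructor
  · rintro ⟨hU, hmin⟩
    refine eq_of_loss_le_tangent S hT hU ?_
    have h1 : llaObjective P S Th₀ U ≤ llaObjective P S Th₀ T := hmin hT
    linarith [key U]
  · rintro rfl
    refine ⟨hT, fun V hV => ?_⟩
    have h1 := loss_tangent_le S hT hV
    have h2 := key V
    show llaObjective P S Th₀ U ≤ llaObjective P S Th₀ V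
    linarith

end Step

/-! ### Folded concave penalties and the deterministic part -/

section Penalty

variable {P : ℝ → ℝ} {lam a a₁ a₂ : ℝ}

lemma IsFoldedConcave.le_penDeriv (hP : IsFoldedConcave P lam a a₁ a₂) {x : ℝ} (hx : 0 ≤ x)
    (hx2 : x ≤ a₂ * lam) : a₁ * lam ≤ penDeriv P x := by
  rcases hx.eq_or_lt with rfl | h
  · exact hP.deriv_zero
  · exact hP.deriv_near x h hx2

end Penalty

lemma minSignal_le {q : ℕ} {Th : Matrix (Fin q) (Fin q) ℝ} {e : Fin q × Fin q}
    (he : e ∈ supp Th) : minSignal Th ≤ |Th e.1 e.2| :=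
  ciInf_le (f := fun e : supp Th => |Th e.1.1 e.1.2|) (Set.finite_range _).bddBelow ⟨e, he⟩

lemma diag_mem_supp_inv {q : ℕ} {Sg : Matrix (Fin q) (Fin q) ℝ} (hSg : Sg.PosDef) (i : Fin q) :
    (i, i) ∈ supp Sg⁻¹ := mem_supp.mpr hSg.inv.diag_pos.ne'

lemma normL1_inv_pos {q : ℕ} (hq : 0 < q) {Sg : Matrix (Fin q) (Fin q) ℝ} (hSg : Sg.PosDef) :
    0 < normL1 Sg⁻¹ := by
  have : Nonempty (Fin q) := ⟨⟨0, hq⟩⟩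
  rw [normL1_eq_normLinf_transpose]
  exact normLinf_pos_of_posDef hSg.inv.transpose

/-- If the noise `S - Sg` is small, the LLA algorithm initialized by any CLIME estimator returns
the oracle estimator in every iteration. -/
theorem lla_eq_oracle_of_noise_le {q : ℕ} (hq : 0 < q) {S Sg : Matrix (Fin q) (Fin q) ℝ}
    (hSg : Sg.PosDef) (hS : Sᵀ = S) {P : ℝ → ℝ} {lam a a₁ a₂ : ℝ}
    (hP : IsFoldedConcave P lam a a₁ a₂) (hmin : (a + 1) * lam < minSignal Sg⁻¹)
    {c : ℝ} (hc : 0 < c) (hcl : 4 * normL1 Sg⁻¹ / min 1 a₂ * c ≤ lam)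
    (hW : ∀ i j, |(S - Sg) i j| ≤ c / normL1 Sg⁻¹)
    {t : ℝ} (ht : 0 ≤ t) (hWA : ∀ e ∈ supp Sg⁻¹, |(S - Sg) e.1 e.2| ≤ t)
    (ht1 : 6 * K1 Sg * K2 Sg * maxDegree Sg⁻¹ * t ≤ 1)
    (ht2 : 6 * K1 Sg ^ 3 * K2 Sg ^ 2 * maxDegree Sg⁻¹ * t ≤ 1)
    (ht3 : (2 * K3 Sg + 1) * t ≤ a₁ * lam / 2)
    (ht4 : 2 * K2 Sg * t ≤ minSignal Sg⁻¹ - a * lam)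
    (hWAc : ∀ e ∉ supp Sg⁻¹, |(S - Sg) e.1 e.2| ≤ a₁ * lam / 2) :
    ∃ oracle : Matrix (Fin q) (Fin q) ℝ,
      (∀ T, IsOracle S (supp Sg⁻¹) T ↔ T = oracle) ∧ (∃ T, IsClime S c T) ∧
        ∀ T, IsClime S c T → ∀ m : ℕ, 1 ≤ m → llaIterates P S T m = {oracle} := by
  have hL := normL1_inv_pos hq hSg
  have ha0 : 0 < min 1 a₂ := lt_min one_pos hP.a₂_pos
  have hlam : 0 < lam := lt_of_lt_of_le (by positivity) hcl
  have hmin1 : min 1 a₂ * lam ≤ lam := by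
    nlinarith [min_le_left 1 a₂]
  have hmin2 : min 1 a₂ * lam ≤ a₂ * lam := mul_le_mul_of_nonneg_right (min_le_right _ _) hlam.le
  -- The CLIME error is at most `a₀ λ`: the bound by `λ` serves on the support, the bound by `a₂ λ`
  -- off it.
  have herr : 2 * normL1 Sg⁻¹ * c ≤ min 1 a₂ * lam := by
    have h1 : 4 * normL1 Sg⁻¹ / min 1 a₂ * c * min 1 a₂ = 4 * normL1 Sg⁻¹ * c := by field_simp
    have h2 := mul_le_mul_of_nonneg_right hcl ha0.le
    rw [h1] at h2
    have : 0 < normL1 Sg⁻¹ * c := mul_pos hL hc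
    linarith
  obtain ⟨T, hT, hTA, hG, hTr, hGc⟩ := exists_restricted_stationary hSg hS ht hWA ht1 ht2
  have hGc' : ∀ e ∉ supp Sg⁻¹, |(S - T⁻¹) e.1 e.2| ≤ a₁ * lam := fun e he => by
    linarith [hGc e he, hWAc e he]
  have hsecond : ∀ U, IsLLAStep P S T U ↔ U = T := by
    refine isLLAStep_iff_eq hT (diag_mem_supp_inv hSg) hTA hG (fun e he _ => ?_) fun e he => ?_
    · refine hP.deriv_far _ ?_
      have h1 := hTr e.1 e.2
      have h2 := minSignal_le he
      have h3 : |Sg⁻¹ e.1 e.2| ≤ |T e.1 e.2| + |(T - Sg⁻¹) e.1 e.2| := by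
        have : Sg⁻¹ e.1 e.2 = T e.1 e.2 - (T - Sg⁻¹) e.1 e.2 := by simp
        rw [this]; exact abs_sub _ _
      linarith
    · rw [hTA e he, abs_zero]
      exact (hGc' e he).trans hP.deriv_zero
  refine ⟨T, isOracle_iff_eq hT hTA hG,
    exists_isClime hc.le (entryMax_mul_inv_sub_one_le hSg hL hc hW), fun T₀ hT₀ m hm => ?_⟩
  have hT₀e := fun i j => (hT₀.abs_sub_inv_le hSg hL hc hW i j).trans herr
  have hfirst : ∀ U, IsLLAStep P S T₀ U ↔ U = T := by
    refine isLLAStep_iff_eq hT (diag_mem_supp_inv hSg) hTA hG (fun e he _ => ?_) fun e he => ?_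
    · refine hP.deriv_far _ ?_
      have h2 := minSignal_le he
      have h3 : |Sg⁻¹ e.1 e.2| ≤ |T₀ e.1 e.2| + |(T₀ - Sg⁻¹) e.1 e.2| := by
        have : Sg⁻¹ e.1 e.2 = T₀ e.1 e.2 - (T₀ - Sg⁻¹) e.1 e.2 := by simp
        rw [this]; exact abs_sub _ _
      linarith [hT₀e e.1 e.2]
    · refine (hGc' e he).trans (hP.le_penDeriv (abs_nonneg _) ?_)
      have h1 := hT₀e e.1 e.2
      rw [Matrix.sub_apply, notMem_supp.mp he, sub_zero] at h1
      exact h1.trans hmin2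
  induction m, hm using Nat.le_induction with
  | base => ext U; simp [llaIterates, hfirst]
  | succ m _ ih => ext U; simp [llaIterates, ih, hsecond]

/-! ### Concentration of the sample variance of Gaussian data -/

/-- Turns the chi-square moment generating function into a quadratic exponent. For `y ≤ 0` use `1 +
x ≤ exp x` and `(1 + y + y²)(1 - y) = 1 - y³ ≥ 1`; for `y > 0` the quadratic Taylor term is needed.
-/
lemma inv_one_sub_le_exp {y : ℝ} (hy : |y| ≤ 1 / 2) : 1 / (1 - y) ≤ Real.exp (y + y ^ 2) := by
  obtain ⟨h1, h2⟩ := abs_le.mp hy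
  rw [div_le_iff₀ (by linarith)]
  rcases le_total y 0 with h | h
  · have := Real.add_one_le_exp (y + y ^ 2)
    nlinarith [mul_nonneg (by linarith : (0 : ℝ) ≤ -y) (sq_nonneg y)]
  · have := Real.quadratic_le_exp_of_nonneg (by positivity : 0 ≤ y + y ^ 2)
    have h3 : 1 ≤ (1 + (y + y ^ 2) + (y + y ^ 2) ^ 2 / 2) * (1 - y) := by
      have : (1 + (y + y ^ 2) + (y + y ^ 2) ^ 2 / 2) * (1 - y) - 1
          = y ^ 2 / 2 * (1 - y - y ^ 2 - y ^ 3) := by ring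
      have h4 : 0 ≤ 1 - y - y ^ 2 - y ^ 3 := by nlinarith [pow_nonneg h 2]
      nlinarith [mul_nonneg (sq_nonneg y) h4]
    exact h3.trans (mul_le_mul_of_nonneg_right this (by linarith))

lemma integral_exp_mul_sq_gaussianReal {v : NNReal} (hv : v ≠ 0) {s : ℝ} (hs : 2 * s * v < 1) :
    ∫ x, Real.exp (s * x ^ 2) ∂(gaussianReal 0 v) = √(1 / (1 - 2 * s * v)) := by
  have hv' : (0 : ℝ) < v := by positivity
  have hb : 0 < 1 / (2 * (v : ℝ)) - s := by
    rw [sub_pos, lt_div_iff₀ (by positivity)]; linarith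
  rw [integral_gaussianReal_eq_integral_smul hv]
  have h1 : ∀ x : ℝ, gaussianPDFReal 0 v x • Real.exp (s * x ^ 2)
      = (√(2 * Real.pi * v))⁻¹ * Real.exp (-(1 / (2 * (v : ℝ)) - s) * x ^ 2) := fun x => by
    rw [gaussianPDFReal_def, smul_eq_mul, mul_assoc, ← Real.exp_add]
    congr 2
    field_simp
    ring
  simp_rw [h1]
  rw [integral_const_mul, integral_gaussian, ← Real.sqrt_inv, ← Real.sqrt_mul (by positivity)]
  congr 1
  have : 1 - 2 * s * v ≠ 0 := by linarith
  have h2 : 1 / (2 * (v : ℝ)) - s = (1 - 2 * s * v) / (2 * v) := by field_simp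
  rw [h2]
  field_simp [Real.pi_ne_zero]

lemma integrable_exp_mul_sq_gaussianReal (v : NNReal) {s : ℝ} (hs : 2 * s * v < 1) :
    Integrable (fun x => Real.exp (s * x ^ 2)) (gaussianReal 0 v) := by
  rcases eq_or_ne v 0 with rfl | hv
  · rw [gaussianReal_zero_var]; exact integrable_dirac (by simp)
  -- The integral of a non-integrable function is 0 by convention, so the explicit positive value
  -- proves integrability.
  · refine Integrable.of_integral_ne_zero ?_
    rw [integral_exp_mul_sq_gaussianReal hv hs]
    have : 0 < 1 - 2 * s * v := by linarith
    positivity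

lemma integral_exp_mul_sq_gaussianReal_le (v : NNReal) {s : ℝ} (hs : |2 * s * v| ≤ 1 / 2) :
    ∫ x, Real.exp (s * x ^ 2) ∂(gaussianReal 0 v) ≤ Real.exp (s * v + 2 * s ^ 2 * v ^ 2) := by
  rcases eq_or_ne v 0 with rfl | hv
  · simp
  · have hs1 : 2 * s * v < 1 := by linarith [(abs_le.mp hs).2]
    rw [integral_exp_mul_sq_gaussianReal hv hs1]
    refine Real.sqrt_le_iff.mpr ⟨by positivity, ?_⟩
    refine (inv_one_sub_le_exp hs).trans (le_of_eq ?_)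
    rw [sq (Real.exp _), ← Real.exp_add]
    congr 1; ring

section Tails

variable {Ω : Type*} [MeasurableSpace Ω] {Pr : Measure Ω} {n : ℕ}
  {Z : Fin n → Ω → ℝ} {v V : NNReal}

/-- The bound `V` stands in for the variance because `v` may vanish, as for `x_j - x_k` with `j =
k`. -/
lemma mgf_sum_sq_le (hZ : iIndepFun Z Pr) (hlaw : ∀ i, HasLaw (Z i) (gaussianReal 0 v) Pr)
    (hvV : v ≤ V) {s : ℝ} (hs : |s| * (4 * V) ≤ 1) :
    Integrable (fun ω => Real.exp (s * (∑ i, fun ω => Z i ω ^ 2) ω)) Pr ∧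
      mgf (∑ i, fun ω => Z i ω ^ 2) Pr s ≤ Real.exp (n * (s * v + 2 * s ^ 2 * V ^ 2)) := by
  have hvV' : (v : ℝ) ≤ V := by exact_mod_cast hvV
  have hs' : |2 * s * v| ≤ 1 / 2 := by
    rw [abs_mul, abs_mul, abs_of_nonneg v.coe_nonneg, abs_of_pos (two_pos (α := ℝ))]
    have := mul_le_mul_of_nonneg_left hvV' (abs_nonneg s)
    linarith
  have hs1 : 2 * s * v < 1 := by linarith [(abs_le.mp hs').2]
  have hindep : iIndepFun (fun i ω => Z i ω ^ 2) Pr :=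
    hZ.comp (fun _ x => x ^ 2) fun _ => by fun_prop
  have hmeas : ∀ i, AEMeasurable (fun ω => Z i ω ^ 2) Pr := fun i => (hlaw i).aemeasurable.pow_const 2
  have hmgf : ∀ i, mgf (fun ω => Z i ω ^ 2) Pr s
      = ∫ x, Real.exp (s * x ^ 2) ∂(gaussianReal 0 v) := fun i => by
    rw [← (hlaw i).map_eq, integral_map (hlaw i).aemeasurable (by fun_prop)]; rfl
  have hpos : ∀ i, 0 < mgf (fun ω => Z i ω ^ 2) Pr s := fun i => by
    rw [hmgf]
    exact integral_exp_pos (integrable_exp_mul_sq_gaussianReal v hs1)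
  have hsum := hindep.mgf_sum₀ (t := s) hmeas Finset.univ
  constructor
  · refine Integrable.of_integral_ne_zero ?_
    change mgf (∑ i, fun ω => Z i ω ^ 2) Pr s ≠ 0
    rw [hsum]
    exact (Finset.prod_pos fun i _ => hpos i).ne'
  · rw [hsum]
    calc ∏ i, mgf (fun ω => Z i ω ^ 2) Pr s
        ≤ ∏ _i : Fin n, Real.exp (s * v + 2 * s ^ 2 * V ^ 2) :=
          Finset.prod_le_prod (fun i _ => (hpos i).le) fun i _ => by
            rw [hmgf]
            refine (integral_exp_mul_sq_gaussianReal_le v hs').trans (Real.exp_le_exp.mpr ?_)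
            gcongr
      _ = _ := by rw [Finset.prod_const, Finset.card_univ, Fintype.card_fin, ← Real.exp_nat_mul]

lemma measure_sum_sq_ge_le [IsProbabilityMeasure Pr] (hZ : iIndepFun Z Pr)
    (hlaw : ∀ i, HasLaw (Z i) (gaussianReal 0 v) Pr) (hvV : v ≤ V) (hV : 0 < V) {τ : ℝ}
    (hτ : 0 ≤ τ) (hτV : τ ≤ V) :
    Pr.real {ω | n * (v + τ) ≤ (∑ i, fun ω => Z i ω ^ 2) ω}
      ≤ Real.exp (-(n * τ ^ 2 / (8 * V ^ 2))) := by
  have hV' : (0 : ℝ) < V := by exact_mod_cast hV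
  -- Minimizer of `-s τ + 2 s² V²`; the condition `τ ≤ V` makes it admissible.
  set s : ℝ := τ / (4 * V ^ 2) with hs
  have hs0 : 0 ≤ s := by positivity
  have hsV : |s| * (4 * V) ≤ 1 := by
    rw [abs_of_nonneg hs0, hs]
    have : τ / (4 * (V : ℝ) ^ 2) * (4 * V) = τ / V := by field_simp
    rw [this]
    exact (div_le_one hV').mpr hτV
  obtain ⟨hint, hle⟩ := mgf_sum_sq_le hZ hlaw hvV hsV
  refine (measure_ge_le_exp_mul_mgf _ hs0 hint).trans ?_
  refine (mul_le_mul_of_nonneg_left hle (Real.exp_nonneg _)).trans (le_of_eq ?_)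
  rw [← Real.exp_add]
  congr 1
  rw [hs]; field_simp; ring

lemma measure_sum_sq_le_le [IsProbabilityMeasure Pr] (hZ : iIndepFun Z Pr)
    (hlaw : ∀ i, HasLaw (Z i) (gaussianReal 0 v) Pr) (hvV : v ≤ V) (hV : 0 < V) {τ : ℝ}
    (hτ : 0 ≤ τ) (hτV : τ ≤ V) :
    Pr.real {ω | (∑ i, fun ω => Z i ω ^ 2) ω ≤ n * (v - τ)}
      ≤ Real.exp (-(n * τ ^ 2 / (8 * V ^ 2))) := by
  have hV' : (0 : ℝ) < V := by exact_mod_cast hV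
  set s : ℝ := -(τ / (4 * V ^ 2)) with hs
  have hs0 : s ≤ 0 := by rw [hs, neg_nonpos]; positivity
  have hsV : |s| * (4 * V) ≤ 1 := by
    rw [abs_of_nonpos hs0, hs, neg_neg]
    have : τ / (4 * (V : ℝ) ^ 2) * (4 * V) = τ / V := by field_simp
    rw [this]
    exact (div_le_one hV').mpr hτV
  obtain ⟨hint, hle⟩ := mgf_sum_sq_le hZ hlaw hvV hsV
  refine (measure_le_le_exp_mul_mgf _ hs0 hint).trans ?_
  refine (mul_le_mul_of_nonneg_left hle (Real.exp_nonneg _)).trans (le_of_eq ?_)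
  rw [← Real.exp_add]
  congr 1
  rw [hs]; field_simp; ring

lemma hasSubgaussianMGF_of_hasLaw {X : Ω → ℝ} (hlaw : HasLaw X (gaussianReal 0 v) Pr)
    (hvV : v ≤ V) : HasSubgaussianMGF X V Pr where
  integrable_exp_mul t := by
    have h := integrable_exp_mul_gaussianReal (μ := 0) (v := v) t
    rw [← hlaw.map_eq] at h
    exact h.comp_aemeasurable hlaw.aemeasurable
  mgf_le t := by
    rw [mgf_gaussianReal hlaw.map_eq]
    refine Real.exp_le_exp.mpr ?_
    have : (v : ℝ) ≤ V := by exact_mod_cast hvV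
    rw [zero_mul, zero_add]
    gcongr

lemma measure_abs_sum_ge_le [IsProbabilityMeasure Pr] (hZ : iIndepFun Z Pr)
    (hlaw : ∀ i, HasLaw (Z i) (gaussianReal 0 v) Pr) (hvV : v ≤ V) {ε : ℝ} (hε : 0 ≤ ε) :
    Pr.real {ω | ε ≤ |∑ i, Z i ω|} ≤ 2 * Real.exp (-ε ^ 2 / (2 * (n * V))) := by
  have h1 := HasSubgaussianMGF.sum_of_iIndepFun hZ (c := fun _ => V) (s := Finset.univ)
    fun i _ => hasSubgaussianMGF_of_hasLaw (hlaw i) hvV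
  have hsub : {ω | ε ≤ |∑ i, Z i ω|} ⊆
      {ω | ε ≤ ∑ i, Z i ω} ∪ {ω | ε ≤ (-fun ω => ∑ i, Z i ω) ω} := fun ω (hω : ε ≤ |_|) => le_abs.mp hω
  have h2 := h1.measure_ge_le hε
  have h3 := h1.neg.measure_ge_le hε
  have hc : ((∑ _i : Fin n, V : NNReal) : ℝ) = n * V := by simp
  rw [hc] at h2 h3
  calc _ ≤ _ := measureReal_mono hsub
    _ ≤ _ := measureReal_union_le _ _
    _ ≤ _ := by linarith

end Tails

/-- The sample variance with factor `1 / n`. -/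
def sampleVar {n : ℕ} (y : Fin n → ℝ) : ℝ := (n : ℝ)⁻¹ * ∑ i, (y i - (n : ℝ)⁻¹ * ∑ l, y l) ^ 2

/-- Centring at the true mean `m` separates a sum of squares from a squared mean, whose deviations
are controlled separately. -/
lemma sampleVar_eq {n : ℕ} (hn : 0 < n) (y : Fin n → ℝ) (m : ℝ) :
    sampleVar y = (n : ℝ)⁻¹ * ∑ i, (y i - m) ^ 2 - ((n : ℝ)⁻¹ * ∑ i, (y i - m)) ^ 2 := by
  have hn' : (n : ℝ) ≠ 0 := by positivity
  set z : Fin n → ℝ := fun i => y i - m with hz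
  have h1 : ∀ i, y i - (n : ℝ)⁻¹ * ∑ l, y l = z i - (n : ℝ)⁻¹ * ∑ l, z l := fun i => by
    simp only [hz, Finset.sum_sub_distrib, Finset.sum_const, Finset.card_univ, Fintype.card_fin,
      nsmul_eq_mul]
    field_simp
    ring
  set b : ℝ := (n : ℝ)⁻¹ * ∑ l, z l with hb
  have h2 : ∑ l, z l = n * b := by rw [hb]; field_simp
  have h3 : ∑ i, (z i - b) ^ 2 = ∑ i, z i ^ 2 - n * b ^ 2 := by
    have : ∀ i, (z i - b) ^ 2 = z i ^ 2 - 2 * b * z i + b ^ 2 := fun i => by ring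
    simp only [this, Finset.sum_add_distrib, Finset.sum_sub_distrib, ← Finset.mul_sum, h2,
      Finset.sum_const, Finset.card_univ, Fintype.card_fin, nsmul_eq_mul]
    ring
  rw [sampleVar]
  simp only [h1]
  rw [h3, mul_sub, inv_mul_cancel_left₀ hn']

/-- The deviation `τ` is split equally between the sum of squares and the squared mean. Two
one-sided tails and one two-sided tail give the factor 4. -/
theorem measure_sampleVar_sub_gt_le {Ω : Type*} [MeasurableSpace Ω] {Pr : Measure Ω}
    [IsProbabilityMeasure Pr] {n : ℕ} (hn : 0 < n) {Y : Fin n → Ω → ℝ} {m : ℝ} {v V : NNReal}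
    (hY : iIndepFun Y Pr) (hlaw : ∀ i, HasLaw (Y i) (gaussianReal m v) Pr) (hvV : v ≤ V)
    (hV : 0 < V) {τ : ℝ} (hτ : 0 < τ) (hτV : τ ≤ V) :
    Pr.real {ω | τ < |sampleVar (fun i => Y i ω) - v|}
      ≤ 4 * Real.exp (-(n * τ ^ 2 / (32 * V ^ 2))) := by
  have hn' : (0 : ℝ) < n := by exact_mod_cast hn
  have hV' : (0 : ℝ) < V := by exact_mod_cast hV
  set Z : Fin n → Ω → ℝ := fun i ω => Y i ω - m with hZdef
  have hZ : iIndepFun Z Pr := hY.comp (fun _ x => x - m) fun _ => by fun_prop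
  have hZlaw : ∀ i, HasLaw (Z i) (gaussianReal 0 v) Pr := fun i => by
    have := gaussianReal_sub_const (hlaw i) m
    rwa [sub_self] at this
  have hτ2 : 0 ≤ τ / 2 := by positivity
  have h1 := measure_sum_sq_ge_le hZ hZlaw hvV hV hτ2 (by linarith)
  have h2 := measure_sum_sq_le_le hZ hZlaw hvV hV hτ2 (by linarith)
  have h3 := measure_abs_sum_ge_le hZ hZlaw hvV (ε := n * √(τ / 2)) (by positivity)
  have he1 : -(n * (τ / 2) ^ 2 / (8 * (V : ℝ) ^ 2)) = -(n * τ ^ 2 / (32 * (V : ℝ) ^ 2)) := by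
    field_simp; ring
  -- The squared mean has an exponent linear in `τ`, which dominates the quadratic one because `τ ≤
  -- V`.
  have he3 : -((n : ℝ) * √(τ / 2)) ^ 2 / (2 * (n * V)) ≤ -(n * τ ^ 2 / (32 * (V : ℝ) ^ 2)) := by
    rw [mul_pow, Real.sq_sqrt hτ2]
    have : -((n : ℝ) ^ 2 * (τ / 2)) / (2 * (n * V)) = -(n * τ * (8 * V) / (32 * (V : ℝ) ^ 2)) := by
      field_simp; ring
    rw [this, neg_le_neg_iff]
    have : (n : ℝ) * τ ^ 2 ≤ n * τ * (8 * V) := by nlinarith [mul_pos hn' hτ]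
    gcongr
  rw [he1] at h1 h2
  have h3' := h3.trans (mul_le_mul_of_nonneg_left (Real.exp_le_exp.mpr he3) two_pos.le)
  have hsub : {ω | τ < |sampleVar (fun i => Y i ω) - v|} ⊆
      ({ω | n * (v + τ / 2) ≤ (∑ i, fun ω => Z i ω ^ 2) ω} ∪
        {ω | (∑ i, fun ω => Z i ω ^ 2) ω ≤ n * (v - τ / 2)}) ∪
        {ω | n * √(τ / 2) ≤ |∑ i, Z i ω|} := by
    intro ω hω
    by_contra hcon
    simp only [Set.mem_union, Set.mem_ofPred_eq, not_or, not_le, Finset.sum_apply] at hcon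
    obtain ⟨⟨ha, hb⟩, hc⟩ := hcon
    change τ < |_| at hω
    refine absurd hω (not_lt.mpr ?_)
    rw [sampleVar_eq hn _ m]
    change |(n : ℝ)⁻¹ * ∑ i, Z i ω ^ 2 - ((n : ℝ)⁻¹ * ∑ i, Z i ω) ^ 2 - v| ≤ τ
    have ha' : (n : ℝ)⁻¹ * ∑ i, Z i ω ^ 2 < v + τ / 2 := by
      rw [inv_mul_lt_iff₀ hn']; exact ha
    have hb' : v - τ / 2 < (n : ℝ)⁻¹ * ∑ i, Z i ω ^ 2 := by
      rw [lt_inv_mul_iff₀ hn']; exact hb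
    have hc' : ((n : ℝ)⁻¹ * ∑ i, Z i ω) ^ 2 ≤ τ / 2 := by
      rw [← Real.sq_sqrt hτ2, ← sq_abs ((n : ℝ)⁻¹ * _), abs_mul, abs_of_pos (inv_pos.mpr hn')]
      refine pow_le_pow_left₀ (by positivity) ?_ 2
      rw [inv_mul_le_iff₀ hn']; exact hc.le
    have := sq_nonneg ((n : ℝ)⁻¹ * ∑ i, Z i ω)
    rw [abs_le]; constructor <;> linarith
  calc _ ≤ _ := measureReal_mono hsub
    _ ≤ _ := (measureReal_union_le _ _).trans (add_le_add_left (measureReal_union_le _ _) _)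
    _ ≤ _ := by linarith

/-! ### Concentration of the sample covariance matrix -/

lemma dotProduct_mulVec_single_add {q : ℕ} {Sg : Matrix (Fin q) (Fin q) ℝ} (hS : Sgᵀ = Sg)
    (j k : Fin q) (α : ℝ) :
    (Pi.single j 1 + α • Pi.single k 1 : Fin q → ℝ) ⬝ᵥ
      Sg *ᵥ (Pi.single j 1 + α • Pi.single k 1) = Sg j j + 2 * α * Sg j k + α ^ 2 * Sg k k := by
  have : Sg k j = Sg j k := congrFun (congrFun hS j) k
  simp [Matrix.mulVec_add, Matrix.mulVec_smul, dotProduct_add, add_dotProduct, this]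
  ring

lemma quadratic_nonneg {q : ℕ} {Sg : Matrix (Fin q) (Fin q) ℝ} (hSg : Sg.PosSemidef)
    (j k : Fin q) (α : ℝ) : 0 ≤ Sg j j + 2 * α * Sg j k + α ^ 2 * Sg k k := by
  have hS : Sgᵀ = Sg := by simpa using hSg.1.eq
  rw [← dotProduct_mulVec_single_add hS]
  have h := hSg.dotProduct_mulVec_nonneg (Pi.single j 1 + α • Pi.single k 1 : Fin q → ℝ)
  rwa [star_trivial] at h

lemma abs_apply_le_of_diag_le {q : ℕ} {Sg : Matrix (Fin q) (Fin q) ℝ} (hSg : Sg.PosSemidef)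
    {M : ℝ} (hM : ∀ i, Sg i i ≤ M) (j k : Fin q) : |Sg j k| ≤ M := by
  have h1 := quadratic_nonneg hSg j k 1
  have h2 := quadratic_nonneg hSg j k (-1)
  have h3 := hM j
  have h4 := hM k
  rw [abs_le]; constructor <;> linarith

/-- A linear functional of a Gaussian vector is Gaussian. The mean `m` is chosen before `x`, so all
observations share it. -/
lemma hasLaw_add_smul {Ω : Type*} [MeasurableSpace Ω] {Pr : Measure Ω} {q : ℕ}
    {Sg : Matrix (Fin q) (Fin q) ℝ} (hSg : Sg.PosSemidef) {mean : EuclideanSpace ℝ (Fin q)}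
    (j k : Fin q) (α : ℝ) :
    ∃ m : ℝ, ∀ x : Ω → EuclideanSpace ℝ (Fin q), HasLaw x (multivariateGaussian mean Sg) Pr →
      HasLaw (fun ω => x ω j + α * x ω k)
        (gaussianReal m (Sg j j + 2 * α * Sg j k + α ^ 2 * Sg k k).toNNReal) Pr := by
  have hS : Sgᵀ = Sg := by simpa using hSg.1.eq
  set u : EuclideanSpace ℝ (Fin q) :=
    EuclideanSpace.single j 1 + α • EuclideanSpace.single k 1 with hu
  refine ⟨(multivariateGaussian mean Sg)[innerSL ℝ u], fun x hx => ?_⟩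
  have h1 : HasLaw (fun y => innerSL ℝ u y) (gaussianReal
      ((multivariateGaussian mean Sg)[innerSL ℝ u])
      (Sg j j + 2 * α * Sg j k + α ^ 2 * Sg k k).toNNReal)
      (multivariateGaussian mean Sg) := by
    refine ⟨by fun_prop, ?_⟩
    have h2 : (u : Fin q → ℝ) = Pi.single j 1 + α • Pi.single k 1 := by
      rw [hu]; ext i; simp [Pi.single_apply]
    rw [← dotProduct_mulVec_single_add hS, ← h2,
      ← covarianceBilin_multivariateGaussian hSg (μ := mean),
      covarianceBilin_self IsGaussian.memLp_two_id]
    exact IsGaussian.map_eq_gaussianReal (innerSL ℝ u)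
  have h3 : (fun ω => x ω j + α * x ω k) = (fun y => innerSL ℝ u y) ∘ x := by
    ext ω
    simp [hu, EuclideanSpace.inner_single_left]
  rw [h3]
  exact h1.comp hx

/-- Polarization, `4ab = (a + b)² - (a - b)²`; the coefficients `1` and `-1` are kept explicit to
match `hasLaw_add_smul`. -/
lemma sampleCov_polarization {n q : ℕ} (x : Fin n → EuclideanSpace ℝ (Fin q)) (j k : Fin q) :
    sampleCov x j k = (sampleVar (fun i => x i j + 1 * x i k) -
      sampleVar (fun i => x i j + (-1) * x i k)) / 4 := by
  simp only [sampleCov, Matrix.of_apply, sampleVar, sampleMean]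
  rw [← mul_sub, ← Finset.sum_sub_distrib, mul_div_assoc, Finset.sum_div]
  congr 1
  refine Finset.sum_congr rfl fun i _ => ?_
  simp only [Finset.sum_add_distrib, ← Finset.mul_sum]
  ring

lemma transpose_sampleCov {n q : ℕ} (x : Fin n → EuclideanSpace ℝ (Fin q)) :
    (sampleCov x)ᵀ = sampleCov x := by
  ext j k
  simp [sampleCov, mul_comm]

/-- Entrywise concentration of the sample covariance matrix of Gaussian data. -/
theorem measure_sampleCov_sub_gt_le {Ω : Type*} [MeasurableSpace Ω] {Pr : Measure Ω}
    [IsProbabilityMeasure Pr] {n q : ℕ} (hn : 0 < n) {Sg : Matrix (Fin q) (Fin q) ℝ}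
    (hSg : Sg.PosSemidef) {M : ℝ} (hM : 0 < M) (hdiag : ∀ i, Sg i i ≤ M)
    {x : Fin n → Ω → EuclideanSpace ℝ (Fin q)} {mean : EuclideanSpace ℝ (Fin q)}
    (hx : iIndepFun x Pr) (hlaw : ∀ i, HasLaw (x i) (multivariateGaussian mean Sg) Pr)
    (j k : Fin q) {t : ℝ} (ht : 0 ≤ t) (htM : t ≤ M) :
    Pr.real {ω | t < |(sampleCov (fun i => x i ω) - Sg) j k|}
      ≤ 8 * Real.exp (-(1 / (128 * M ^ 2)) * n * t ^ 2) := by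
  rcases ht.eq_or_lt with rfl | ht0
  · refine measureReal_le_one.trans ?_
    norm_num
  have hent := abs_le.mp (abs_apply_le_of_diag_le hSg hdiag j k)
  -- Each variance is at most `4M` and may deviate by `2t`, since polarization divides by 4. The
  -- exponent becomes `n (2t)² / (32 (4M)²) = n t² / (128 M²)`.
  have tail : ∀ α : ℝ, α ^ 2 = 1 →
      Pr.real {ω | 2 * t < |sampleVar (fun i => x i ω j + α * x i ω k) -
        (Sg j j + 2 * α * Sg j k + α ^ 2 * Sg k k)|}
        ≤ 4 * Real.exp (-(1 / (128 * M ^ 2)) * n * t ^ 2) := fun α hα => by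
    obtain ⟨m, hm⟩ := hasLaw_add_smul (Pr := Pr) hSg (mean := mean) j k α
    have hvn := quadratic_nonneg hSg j k α
    have hvV : (Sg j j + 2 * α * Sg j k + α ^ 2 * Sg k k).toNNReal ≤ (4 * M).toNNReal := by
      refine Real.toNNReal_le_toNNReal ?_
      have h3 := hdiag j
      have h4 := hdiag k
      rcases sq_eq_sq_iff_eq_or_eq_neg.mp (hα.trans (one_pow 2).symm) with rfl | rfl <;> linarith
    have hindep : iIndepFun (fun i ω => x i ω j + α * x i ω k) Pr :=
      hx.comp (fun _ y => y j + α * y k) fun _ => by fun_prop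
    have h := measure_sampleVar_sub_gt_le hn hindep (fun i => hm (x i) (hlaw i)) hvV
      (by simpa using hM) (τ := 2 * t) (by positivity)
      (by rw [Real.coe_toNNReal _ (by positivity)]; linarith)
    rw [Real.coe_toNNReal _ hvn, Real.coe_toNNReal _ (by positivity)] at h
    refine h.trans (le_of_eq ?_)
    congr 2
    field_simp
    ring
  have hsub : {ω | t < |(sampleCov (fun i => x i ω) - Sg) j k|} ⊆
      {ω | 2 * t < |sampleVar (fun i => x i ω j + 1 * x i ω k) -
        (Sg j j + 2 * 1 * Sg j k + 1 ^ 2 * Sg k k)|} ∪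
      {ω | 2 * t < |sampleVar (fun i => x i ω j + (-1) * x i ω k) -
        (Sg j j + 2 * (-1) * Sg j k + (-1) ^ 2 * Sg k k)|} := by
    intro ω hω
    by_contra hcon
    simp only [Set.mem_union, Set.mem_ofPred_eq, not_or, not_lt] at hcon
    obtain ⟨ha, hb⟩ := hcon
    change t < |_| at hω
    refine absurd hω (not_lt.mpr ?_)
    rw [Matrix.sub_apply, sampleCov_polarization]
    obtain ⟨ha1, ha2⟩ := abs_le.mp ha
    obtain ⟨hb1, hb2⟩ := abs_le.mp hb
    rw [abs_le]; constructor <;> linarith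
  calc _ ≤ _ := measureReal_mono hsub
    _ ≤ _ := measureReal_union_le _ _
    _ ≤ _ := by linarith [tail 1 (by norm_num), tail (-1) (by norm_num)]

/-! ### The exceptional event -/

lemma card_filter_le (q : ℕ) :
    ((Finset.univ.filter fun e : Fin q × Fin q => e.1 ≤ e.2).card : ℝ) = dimParam q := by
  have h1 : (Finset.univ.filter fun e : Fin q × Fin q => e.1 ≤ e.2).card
      = ∑ k ∈ Finset.range q, (k + 1) := by
    rw [Finset.card_filter, Fintype.sum_prod_type_right, ← Fin.sum_univ_eq_sum_range]
    refine Finset.sum_congr rfl fun k _ => ?_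
    rw [← Finset.card_filter, ← Fin.card_Iic]
    congr 1
    ext i; simp
  have h2 : ∀ r : ℕ, ((∑ k ∈ Finset.range r, (k + 1) : ℕ) : ℝ) = dimParam r := fun r => by
    induction r with
    | zero => simp [dimParam]
    | succ r ih => rw [Finset.sum_range_succ, Nat.cast_add, ih, dimParam, dimParam]; push_cast; ring
  rw [h1, h2]

lemma card_filter_notMem_supp {q : ℕ} (Th : Matrix (Fin q) (Fin q) ℝ) :
    ((Finset.univ.filter fun e : Fin q × Fin q => e ∉ supp Th ∧ e.1 ≤ e.2).card : ℝ)
      = dimParam q - sparsity Th := by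
  rw [← card_filter_le, sparsity, eq_sub_iff_add_eq]
  norm_cast
  rw [← Finset.card_filter_add_card_filter_not
    (s := Finset.univ.filter fun e : Fin q × Fin q => e.1 ≤ e.2) (fun e => e ∈ supp Th), add_comm]
  congr 2
  · ext e; simp [and_comm]
  · ext e; simp [and_comm]

section Union

variable {Ω : Type*} [MeasurableSpace Ω] {Pr : Measure Ω} [IsProbabilityMeasure Pr] {n q : ℕ}
  {Sg : Matrix (Fin q) (Fin q) ℝ} {M : ℝ} {x : Fin n → Ω → EuclideanSpace ℝ (Fin q)}
  {mean : EuclideanSpace ℝ (Fin q)}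

/-- Some entry of the noise with position in `F` exceeds `t` while not exceeding `u`. -/
def exceedance {q : ℕ} (F : Finset (Fin q × Fin q)) (W : Ω → Matrix (Fin q) (Fin q) ℝ)
    (t u : ℝ) : Set Ω := ⋃ e ∈ F, {ω | t < |W ω e.1 e.2| ∧ |W ω e.1 e.2| ≤ u}

/-- No upper bound on `t` is required: for `t > u` the event is empty, and for `t ≤ u ≤ M` the
entrywise tail applies. -/
lemma measure_exceedance_le (hn : 0 < n) (hSg : Sg.PosSemidef) (hM : 0 < M)
    (hdiag : ∀ i, Sg i i ≤ M) (hx : iIndepFun x Pr)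
    (hlaw : ∀ i, HasLaw (x i) (multivariateGaussian mean Sg) Pr) (F : Finset (Fin q × Fin q))
    {t u : ℝ} (ht : 0 ≤ t) (hu : u ≤ M) :
    Pr.real (exceedance F (fun ω => sampleCov (fun i => x i ω) - Sg) t u)
      ≤ 8 * F.card * Real.exp (-(1 / (128 * M ^ 2)) * n * t ^ 2) := by
  refine (measureReal_biUnion_finset_le F _).trans ?_
  calc _ ≤ ∑ _e ∈ F, 8 * Real.exp (-(1 / (128 * M ^ 2)) * n * t ^ 2) := by
        refine Finset.sum_le_sum fun e _ => ?_
        rcases le_or_gt t u with htu | htu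
        · exact (measureReal_mono fun ω hω => hω.1).trans (measure_sampleCov_sub_gt_le hn hSg hM hdiag
            hx hlaw e.1 e.2 ht (htu.trans hu))
        · have : {ω | t < |(sampleCov (fun i => x i ω) - Sg) e.1 e.2| ∧
              |(sampleCov (fun i => x i ω) - Sg) e.1 e.2| ≤ u} = ∅ :=
            Set.eq_empty_of_forall_notMem fun ω hω => absurd (hω.1.trans_le hω.2) htu.not_gt
          rw [this, measureReal_empty]
          positivity
    _ = _ := by rw [Finset.sum_const, nsmul_eq_mul]; ring

end Union

lemma exists_le_of_notMem_exceedance {Ω : Type*} {q : ℕ} {F : Finset (Fin q × Fin q)}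
    {W : Ω → Matrix (Fin q) (Fin q) ℝ} {t u : ℝ} {ω : Ω} (hω : ω ∉ exceedance F W t u)
    {e : Fin q × Fin q} (he : e ∈ F) (hu : |W ω e.1 e.2| ≤ u) : |W ω e.1 e.2| ≤ t := by
  by_contra! h
  exact hω (Set.mem_biUnion he ⟨h, hu⟩)

/-- A bound on the noise on and above the diagonal gives a bound everywhere. -/
lemma abs_le_of_upper {q : ℕ} {W : Matrix (Fin q) (Fin q) ℝ} (hW : Wᵀ = W)
    {p : Fin q × Fin q → Prop} (hp : ∀ e, p e.swap ↔ p e) {t : ℝ}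
    (h : ∀ e, p e → e.1 ≤ e.2 → |W e.1 e.2| ≤ t) (e : Fin q × Fin q) (he : p e) :
    |W e.1 e.2| ≤ t := by
  rcases le_total e.1 e.2 with h1 | h1
  · exact h e he h1
  · have h2 : W e.2 e.1 = W e.1 e.2 := congrFun (congrFun hW e.1) e.2
    rw [← h2]
    exact h e.swap ((hp e).mpr he) h1

/-- The complement of a measurable hull of `B`; the bad event itself need not be shown measurable.
-/
lemma exists_measurableSet_subset_compl {Ω : Type*} [MeasurableSpace Ω] (Pr : Measure Ω)
    [IsProbabilityMeasure Pr] (B : Set Ω) :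
    ∃ E, MeasurableSet E ∧ E ⊆ Bᶜ ∧ Pr.real E = 1 - Pr.real B := by
  refine ⟨(toMeasurable Pr B)ᶜ, (measurableSet_toMeasurable _ _).compl,
    Set.compl_subset_compl.mpr (subset_toMeasurable _ _), ?_⟩
  rw [probReal_compl_eq_one_sub (measurableSet_toMeasurable _ _), measureReal_def,
    measure_toMeasurable, measureReal_def]

/-! ### The radii of the noise on the support -/

/-- Translates a term `1 / (9 B²)` of the minima into a smallness condition on the radius; for `B =
0`, where division yields 0, the claim is trivial. -/
lemma mul_le_one_of_sq_le {B r : ℝ} (hr : r ≤ 1 / (9 * B ^ 2)) (hB : 0 ≤ B) : 3 * B * √r ≤ 1 := by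
  rcases hB.eq_or_lt with rfl | hB
  · simp
  · have h1 : √r ≤ 1 / (3 * B) := by
      refine Real.sqrt_le_iff.mpr ⟨by positivity, hr.trans (le_of_eq ?_)⟩
      field_simp; norm_num
    calc 3 * B * √r ≤ 3 * B * (1 / (3 * B)) := by gcongr
      _ = 1 := by field_simp

section Radii

variable {q : ℕ} (Sg : Matrix (Fin q) (Fin q) ℝ)

/-- The minimum in the exponent of `delta1`. -/
def rate1 (a₁ lam : ℝ) : ℝ :=
  min (a₁ ^ 2 * lam ^ 2 / (2 * K3 Sg + 1) ^ 2)
    (min (1 / (9 * K1 Sg ^ 2 * K2 Sg ^ 2 * (maxDegree Sg⁻¹ : ℝ) ^ 2))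
      (1 / (9 * K1 Sg ^ 6 * K2 Sg ^ 4 * (maxDegree Sg⁻¹ : ℝ) ^ 2)))

/-- The minimum in the exponent of `delta2`. -/
def rate2 (a lam : ℝ) : ℝ :=
  min (1 / (9 * K1 Sg ^ 2 * (maxDegree Sg⁻¹ : ℝ) ^ 2))
    (min (1 / (9 * K1 Sg ^ 6 * K2 Sg ^ 2 * (maxDegree Sg⁻¹ : ℝ) ^ 2))
      ((minSignal Sg⁻¹ - a * lam) ^ 2))

lemma rate1_nonneg (a₁ lam : ℝ) : 0 ≤ rate1 Sg a₁ lam := by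
  have h1 := K1_nonneg Sg
  have h2 := K2_nonneg Sg
  unfold rate1
  positivity

lemma rate2_nonneg (a lam : ℝ) : 0 ≤ rate2 Sg a lam := by
  have h1 := K1_nonneg Sg
  have h2 := K2_nonneg Sg
  unfold rate2
  positivity

lemma rate1_spec {a₁ lam : ℝ} (h : 0 ≤ a₁ * lam) :
    6 * K1 Sg * K2 Sg * maxDegree Sg⁻¹ * (√(rate1 Sg a₁ lam) / 2) ≤ 1 ∧
    6 * K1 Sg ^ 3 * K2 Sg ^ 2 * maxDegree Sg⁻¹ * (√(rate1 Sg a₁ lam) / 2) ≤ 1 ∧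
    (2 * K3 Sg + 1) * (√(rate1 Sg a₁ lam) / 2) ≤ a₁ * lam / 2 := by
  have h1 := K1_nonneg Sg
  have h2 := K2_nonneg Sg
  have h3 := K3_nonneg Sg
  refine ⟨?_, ?_, ?_⟩
  · have := mul_le_one_of_sq_le (B := K1 Sg * K2 Sg * maxDegree Sg⁻¹) (r := rate1 Sg a₁ lam)
      (((min_le_right _ _).trans (min_le_left _ _)).trans (le_of_eq (by ring))) (by positivity)
    linarith
  · have := mul_le_one_of_sq_le (B := K1 Sg ^ 3 * K2 Sg ^ 2 * maxDegree Sg⁻¹)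
      (r := rate1 Sg a₁ lam)
      (((min_le_right _ _).trans (min_le_right _ _)).trans (le_of_eq (by ring))) (by positivity)
    linarith
  · have h4 : √(rate1 Sg a₁ lam) ≤ a₁ * lam / (2 * K3 Sg + 1) :=
      Real.sqrt_le_iff.mpr ⟨by positivity, (min_le_left _ _).trans (le_of_eq (by rw [div_pow, mul_pow]))⟩
    rw [le_div_iff₀ (by positivity)] at h4
    linarith

lemma rate2_spec {a lam : ℝ} (hK : 0 < K2 Sg) (h : 0 ≤ minSignal Sg⁻¹ - a * lam) :
    6 * K1 Sg * K2 Sg * maxDegree Sg⁻¹ * (√(rate2 Sg a lam) / (2 * K2 Sg)) ≤ 1 ∧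
    6 * K1 Sg ^ 3 * K2 Sg ^ 2 * maxDegree Sg⁻¹ * (√(rate2 Sg a lam) / (2 * K2 Sg)) ≤ 1 ∧
    2 * K2 Sg * (√(rate2 Sg a lam) / (2 * K2 Sg)) ≤ minSignal Sg⁻¹ - a * lam := by
  have h1 := K1_nonneg Sg
  refine ⟨?_, ?_, ?_⟩
  · have := mul_le_one_of_sq_le (B := K1 Sg * maxDegree Sg⁻¹) (r := rate2 Sg a lam)
      ((min_le_left _ _).trans (le_of_eq (by ring))) (by positivity)
    refine le_trans (le_of_eq ?_) this
    field_simp; ring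
  · have := mul_le_one_of_sq_le (B := K1 Sg ^ 3 * K2 Sg * maxDegree Sg⁻¹) (r := rate2 Sg a lam)
      (((min_le_right _ _).trans (min_le_left _ _)).trans (le_of_eq (by ring))) (by positivity)
    refine le_trans (le_of_eq ?_) this
    field_simp; ring
  · rw [mul_div_cancel₀ _ (by positivity)]
    exact Real.sqrt_le_iff.mpr ⟨h, (min_le_right _ _).trans (min_le_right _ _)⟩

end Radii

lemma K2_pos {q : ℕ} (hq : 0 < q) {Sg : Matrix (Fin q) (Fin q) ℝ} (hSg : Sg.PosDef) :
    0 < K2 Sg := by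
  have : Nonempty (supp Sg⁻¹) := ⟨⟨_, diag_mem_supp_inv hSg ⟨0, hq⟩⟩⟩
  exact normLinf_pos_of_posDef (posDef_hessBlock hSg _).inv

/-- The radius `λ_clime / L` does not exceed the maximal variance. -/
lemma clime_radius_le {q : ℕ} (hq : 0 < q) {Sg : Matrix (Fin q) (Fin q) ℝ} (hSg : Sg.PosDef)
    {M : ℝ} (hM : 0 < M) (hdiag : ∀ i, Sg i i ≤ M) {lam a a₂ c : ℝ} (ha₂ : 0 < a₂) (ha : 0 < a)
    (hc : 0 < c) (hmin : (a + 1) * lam < minSignal Sg⁻¹)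
    (hcl : 4 * normL1 Sg⁻¹ / min 1 a₂ * c ≤ lam) : c / normL1 Sg⁻¹ ≤ M := by
  have hL := normL1_inv_pos hq hSg
  have ha0 : 0 < min 1 a₂ := lt_min one_pos ha₂
  have hlam : 0 < lam := lt_of_lt_of_le (by positivity) hcl
  have hSd := (Matrix.isUnit_iff_isUnit_det _).mp hSg.isUnit
  set i₀ : Fin q := ⟨0, hq⟩
  have hsig : minSignal Sg⁻¹ ≤ normL1 Sg⁻¹ := by
    refine (minSignal_le (diag_mem_supp_inv hSg i₀)).trans ?_
    refine le_trans ?_ (row_sum_le_normLinf (Sg⁻¹)ᵀ i₀)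
    exact Finset.single_le_sum (f := fun j => |(Sg⁻¹)ᵀ i₀ j|) (fun _ _ => abs_nonneg _)
      (Finset.mem_univ i₀)
  -- Chain `4 L c ≤ λ ≤ (a + 1) λ < minSignal ≤ L`.
  have hc1 : c ≤ 1 := by
    have h1 : 4 * normL1 Sg⁻¹ * c ≤ 4 * normL1 Sg⁻¹ / min 1 a₂ * c := by
      refine mul_le_mul_of_nonneg_right ?_ hc.le
      rw [le_div_iff₀ ha0]
      nlinarith [min_le_left 1 a₂]
    nlinarith [mul_pos ha hlam]
  -- A diagonal entry of `Sg Sg⁻¹ = 1`, with the entries of `Sg` bounded by `M`.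
  have hML : 1 ≤ M * normL1 Sg⁻¹ := by
    have h := abs_mul_apply_le' Sg Sg⁻¹ (abs_apply_le_of_diag_le hSg.posSemidef hdiag) hM.le i₀ i₀
    rwa [Matrix.mul_nonsing_inv _ hSd, Matrix.one_apply_eq, abs_one] at h
  rw [div_le_iff₀ hL]
  linarith

end PrecisionLLA

end

/-- `C₀` and `c₀` depend only on `M = max_i σ⋆_{ii}`. On an event of the stated probability the
oracle estimator exists and is unique, a CLIME estimator exists, and, whichever CLIME estimator
initializes the LLA algorithm and whichever minimizers its iterations pick, the first iterate is
the oracle estimator, so is the second, and so are all later ones. -/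
theorem corollary7 (M : ℝ) (hM : 0 < M) :
    ∃ C₀ c₀ : ℝ, 0 < C₀ ∧ 0 < c₀ ∧
      ∀ (n q : ℕ), 0 < n → 0 < q →
      ∀ (Sg : Matrix (Fin q) (Fin q) ℝ), Sg.PosDef → PrecisionLLA.maxVar Sg = M →
      ∀ (P : ℝ → ℝ) (lam a a₁ a₂ : ℝ), PrecisionLLA.IsFoldedConcave P lam a a₁ a₂ →
      (a + 1) * lam < PrecisionLLA.minSignal Sg⁻¹ →
      ∀ (lamClime : ℝ), 0 < lamClime →
      4 * PrecisionLLA.normL1 Sg⁻¹ / min 1 a₂ * lamClime ≤ lam →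
      ∀ (Ω : Type*) [MeasurableSpace Ω] (Pr : Measure Ω) [IsProbabilityMeasure Pr]
        (x : Fin n → Ω → EuclideanSpace ℝ (Fin q)) (mean : EuclideanSpace ℝ (Fin q)),
      iIndepFun x Pr → (∀ i, HasLaw (x i) (multivariateGaussian mean Sg) Pr) →
      ∃ E : Set Ω, MeasurableSet E ∧
        1 - C₀ * PrecisionLLA.dimParam q *
              Real.exp (-(c₀ * n / PrecisionLLA.normL1 Sg⁻¹ ^ 2) * lamClime ^ 2)
            - PrecisionLLA.delta1 C₀ c₀ n Sg a₁ lam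
            - PrecisionLLA.delta2 C₀ c₀ n Sg a lam ≤ Pr.real E ∧
        ∀ ω ∈ E, ∃ oracle : Matrix (Fin q) (Fin q) ℝ,
          (∀ T, PrecisionLLA.IsOracle (PrecisionLLA.sampleCov fun i => x i ω)
            (PrecisionLLA.supp Sg⁻¹) T ↔ T = oracle) ∧
          (∃ T, PrecisionLLA.IsClime (PrecisionLLA.sampleCov fun i => x i ω) lamClime T) ∧
          ∀ T, PrecisionLLA.IsClime (PrecisionLLA.sampleCov fun i => x i ω) lamClime T →
            ∀ m : ℕ, 1 ≤ m →
              PrecisionLLA.llaIterates P (PrecisionLLA.sampleCov fun i => x i ω) T m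
                = {oracle} := by
  -- The constants of the entrywise tail bound.
  refine ⟨8, 1 / (128 * M ^ 2), by norm_num, by positivity, ?_⟩
  intro n q hn hq Sg hSg hmax P lam a a₁ a₂ hP hmin c hc hcl Ω _ Pr _ x mean hx hlaw
  have hdiag : ∀ i, Sg i i ≤ M := fun i =>
    hmax ▸ le_ciSup (f := fun i => Sg i i) (Set.finite_range _).bddAbove i
  have hTht : (Sg⁻¹)ᵀ = Sg⁻¹ := by simpa using hSg.inv.1.eq
  have hSgt : Sgᵀ = Sg := by simpa using hSg.1.eq
  have hL := PrecisionLLA.normL1_inv_pos hq hSg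
  have ha0 : 0 < min 1 a₂ := lt_min one_pos hP.a₂_pos
  have ha : 0 < a := hP.a₂_pos.trans hP.a₂_lt
  have hlam : 0 < lam := lt_of_lt_of_le (by positivity) hcl
  have hal : 0 ≤ a₁ * lam := (mul_pos hP.a₁_pos hlam).le
  have hK2 := PrecisionLLA.K2_pos hq hSg
  have hrad := PrecisionLLA.clime_radius_le hq hSg hM hdiag hP.a₂_pos ha hc hmin hcl
  have hgap : 0 ≤ PrecisionLLA.minSignal Sg⁻¹ - a * lam := by linarith
  obtain ⟨r11, r12, r13⟩ := PrecisionLLA.rate1_spec Sg hal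
  obtain ⟨r21, r22, r23⟩ := PrecisionLLA.rate2_spec Sg hK2 hgap
  set L := PrecisionLLA.normL1 Sg⁻¹ with hLdef
  set t₁ : ℝ := √(PrecisionLLA.rate1 Sg a₁ lam) / 2 with ht₁
  set t₂ : ℝ := √(PrecisionLLA.rate2 Sg a lam) / (2 * PrecisionLLA.K2 Sg) with ht₂
  have ht₁0 : 0 ≤ t₁ := by positivity
  have ht₂0 : 0 ≤ t₂ := by positivity
  set A := PrecisionLLA.supp Sg⁻¹ with hA
  set W : Ω → Matrix (Fin q) (Fin q) ℝ := fun ω =>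
    PrecisionLLA.sampleCov (fun i => x i ω) - Sg with hW
  set F₀ := Finset.univ.filter fun e : Fin q × Fin q => e.1 ≤ e.2
  set FA := A.filter fun e => e.1 ≤ e.2
  set FC := Finset.univ.filter fun e : Fin q × Fin q => e ∉ A ∧ e.1 ≤ e.2
  have b₀ : Pr.real (⋃ e ∈ F₀, {ω | c / L < |W ω e.1 e.2|}) ≤
      8 * F₀.card * Real.exp (-(1 / (128 * M ^ 2)) * n * (c / L) ^ 2) := by
    refine (measureReal_biUnion_finset_le F₀ _).trans ?_
    refine (Finset.sum_le_sum fun e _ => PrecisionLLA.measure_sampleCov_sub_gt_le hn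
      hSg.posSemidef hM hdiag hx hlaw e.1 e.2 (by positivity) hrad).trans (le_of_eq ?_)
    rw [Finset.sum_const, nsmul_eq_mul]; ring
  -- Truncation at `c / L ≤ M` costs nothing: outside `B₀` every entry of the noise is below `c /
  -- L`.
  have b₁ := PrecisionLLA.measure_exceedance_le hn hSg.posSemidef hM hdiag hx hlaw FA ht₁0 hrad
  have b₂ := PrecisionLLA.measure_exceedance_le hn hSg.posSemidef hM hdiag hx hlaw FA ht₂0 hrad
  have b₃ := PrecisionLLA.measure_exceedance_le hn hSg.posSemidef hM hdiag hx hlaw FC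
    (t := a₁ * lam / 2) (by positivity) hrad
  set B₀ := ⋃ e ∈ F₀, {ω | c / L < |W ω e.1 e.2|}
  set B₁ := PrecisionLLA.exceedance FA W t₁ (c / L)
  set B₂ := PrecisionLLA.exceedance FA W t₂ (c / L)
  set B₃ := PrecisionLLA.exceedance FC W (a₁ * lam / 2) (c / L)
  obtain ⟨E, hE, hEB, hEP⟩ :=
    PrecisionLLA.exists_measurableSet_subset_compl Pr (B₀ ∪ B₁ ∪ B₃ ∪ B₂)
  refine ⟨E, hE, ?_, fun ω hω => ?_⟩
  · have hB : Pr.real (B₀ ∪ B₁ ∪ B₃ ∪ B₂) ≤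
        Pr.real B₀ + Pr.real B₁ + Pr.real B₃ + Pr.real B₂ := by
      linarith [measureReal_union_le (μ := Pr) (B₀ ∪ B₁ ∪ B₃) B₂,
        measureReal_union_le (μ := Pr) (B₀ ∪ B₁) B₃, measureReal_union_le (μ := Pr) B₀ B₁]
    have c₀ : (F₀.card : ℝ) = PrecisionLLA.dimParam q := PrecisionLLA.card_filter_le q
    have cC : (FC.card : ℝ) = PrecisionLLA.dimParam q - PrecisionLLA.sparsity Sg⁻¹ :=
      PrecisionLLA.card_filter_notMem_supp Sg⁻¹
    have e₀ : -(1 / (128 * M ^ 2)) * n * (c / L) ^ 2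
        = -(1 / (128 * M ^ 2) * n / L ^ 2) * c ^ 2 := by ring
    have e₁ : -(1 / (128 * M ^ 2)) * n * t₁ ^ 2
        = -(1 / (128 * M ^ 2) / 4) * n * PrecisionLLA.rate1 Sg a₁ lam := by
      rw [ht₁, div_pow, Real.sq_sqrt (PrecisionLLA.rate1_nonneg _ _ _)]; ring
    have e₂ : -(1 / (128 * M ^ 2)) * n * t₂ ^ 2
        = -(1 / (128 * M ^ 2) * n / (4 * PrecisionLLA.K2 Sg ^ 2)) *
          PrecisionLLA.rate2 Sg a lam := by
      rw [ht₂, div_pow, Real.sq_sqrt (PrecisionLLA.rate2_nonneg _ _ _)]; ring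
    have e₃ : -(1 / (128 * M ^ 2)) * n * (a₁ * lam / 2) ^ 2
        = -(1 / (128 * M ^ 2) * a₁ ^ 2 / 4) * n * lam ^ 2 := by ring
    rw [e₀, c₀] at b₀
    rw [e₁] at b₁
    rw [e₂] at b₂
    rw [e₃, cC] at b₃
    rw [hEP]
    have d₁ : PrecisionLLA.delta1 8 (1 / (128 * M ^ 2)) n Sg a₁ lam =
        8 * FA.card * Real.exp (-(1 / (128 * M ^ 2) / 4) * n * PrecisionLLA.rate1 Sg a₁ lam) +
        8 * (PrecisionLLA.dimParam q - PrecisionLLA.sparsity Sg⁻¹) *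
          Real.exp (-(1 / (128 * M ^ 2) * a₁ ^ 2 / 4) * n * lam ^ 2) := rfl
    have d₂ : PrecisionLLA.delta2 8 (1 / (128 * M ^ 2)) n Sg a lam =
        8 * FA.card * Real.exp (-(1 / (128 * M ^ 2) * n / (4 * PrecisionLLA.K2 Sg ^ 2)) *
          PrecisionLLA.rate2 Sg a lam) := rfl
    rw [d₁, d₂]
    linarith
  · have hnot := hEB hω
    simp only [Set.mem_compl_iff, Set.mem_union, not_or] at hnot
    obtain ⟨⟨⟨n₀, n₁⟩, n₃⟩, n₂⟩ := hnot
    have hS := PrecisionLLA.transpose_sampleCov fun i => x i ω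
    have hWt : (W ω)ᵀ = W ω := by rw [hW, Matrix.transpose_sub, hS, hSgt]
    have hswap : ∀ e : Fin q × Fin q, e.swap ∈ A ↔ e ∈ A := fun e =>
      PrecisionLLA.swap_mem_supp hTht
    have w₀ : ∀ e : Fin q × Fin q, |W ω e.1 e.2| ≤ c / L := fun e => by
      refine PrecisionLLA.abs_le_of_upper hWt (p := fun _ => True) (fun _ => Iff.rfl)
        (fun e _ he => ?_) e trivial
      by_contra! h
      exact n₀ (Set.mem_biUnion (by simpa [F₀] using he) h)
    have wA : ∀ e ∈ A, |W ω e.1 e.2| ≤ min t₁ t₂ := by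
      refine PrecisionLLA.abs_le_of_upper hWt hswap fun e he h => le_min ?_ ?_
      · exact PrecisionLLA.exists_le_of_notMem_exceedance n₁ (Finset.mem_filter.mpr ⟨he, h⟩) (w₀ e)
      · exact PrecisionLLA.exists_le_of_notMem_exceedance n₂ (Finset.mem_filter.mpr ⟨he, h⟩) (w₀ e)
    have wC : ∀ e ∉ A, |W ω e.1 e.2| ≤ a₁ * lam / 2 := by
      refine PrecisionLLA.abs_le_of_upper hWt (p := fun e => e ∉ A)
        (fun e => not_congr (hswap e)) fun e he h => ?_
      exact PrecisionLLA.exists_le_of_notMem_exceedance n₃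
        (Finset.mem_filter.mpr ⟨Finset.mem_univ _, he, h⟩) (w₀ e)
    have hK1 := PrecisionLLA.K1_nonneg Sg
    have hK3 := PrecisionLLA.K3_nonneg Sg
    -- With radius `min t₁ t₂`, the conditions for the stationary point and its gradient come from
    -- `t₁`, and the distance of the oracle to the truth from `t₂`.
    refine PrecisionLLA.lla_eq_oracle_of_noise_le hq hSg hS hP hmin hc hcl
      (fun i j => w₀ (i, j)) (le_min ht₁0 ht₂0) wA ?_ ?_ ?_ ?_ wC
    · exact (mul_le_mul_of_nonneg_left (min_le_left _ _) (by positivity)).trans r11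
    · exact (mul_le_mul_of_nonneg_left (min_le_left _ _) (by positivity)).trans r12
    · exact (mul_le_mul_of_nonneg_left (min_le_left _ _) (by positivity)).trans r13
    · exact (mul_le_mul_of_nonneg_left (min_le_right _ _) (by positivity)).trans r23
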